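/- Let $X$ be a $\mathrm{CAT}(0)$ space (a geodesic metric space whose geodesic triangles are no fatter than their Euclidean comparison triangles; $X$ need not be proper or complete), let $\Gamma$ be a group acting on $X$ by isometries, and fix a base point $x_0\in X$. For a set $S\subset X$ and $x\in X$ let $\pi_S(x)$ be the set of points of $S$ at minimal distance from $x$. A geodesic segment $S$ is $B$-contracting if for every metric ball $K$ disjoint from $S$ the set $\bigcup_{x\in K}\pi_S(x)$ has diameter $<B$. An element $g\in\Gamma$ acts as a rank 1 isometry if, with $x_n=g^n(x_0)$, one has $d(x_n,x_0)\to\infty$ as $n\to\infty$, and there is $B>0$ such that for every $n>0$ some geodesic $[x_0,x_n]$ and the set $\{x_0,x_1,\dots,x_n\}$ are contained in the $B$-neighbourhoods of each other, and some geodesic $[x_0,x_n]$ is $B$-contracting. The action satisfies WPD (weak proper discontinuity) if $\Gamma$ is not virtually cyclic, $\Gamma$ contains an element acting as a rank 1 isometry, and for every $g\in\Gamma$ acting as a rank 1 isometry and every $c>0$ there is an integer $M>0$ such that the set $$\{\gamma\in\Gamma : d(x_0,\gamma x_0)\le c,\ d(g^M x_0,\gamma g^M x_0)\le c\}$$ is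 finite. Suppose that $\Gamma$ is not virtually cyclic, that the action satisfies WPD, and that $\Gamma$ contains an element that acts as a rank 1 isometry. Then the real vector space $$\widetilde{QH}(\Gamma)=\{\text{homogeneous quasi-homomorphisms } \phi:\Gamma\to\mathbb R\}/\mathrm{Hom}(\Gamma,\mathbb R)$$ is infinite-dimensional, where $\phi$ is a quasi-homomorphism if $\sup_{x,y\in\Gamma}|\phi(xy)-\phi(x)-\phi(y)|<\infty$, and is homogeneous if $\phi(g^n)=n\phi(g)$ for all $g\in\Gamma$, $n\in\mathbb Z$. -/

import Mathlib

open Set Filter Topology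

section Geodesics

variable {X : Type*} [MetricSpace X]

/-- `S` is (the image of) a geodesic segment from `a` to `b`: the image of an isometric embedding
`γ : [0, dist a b] → X` with `γ 0 = a` and `γ (dist a b) = b`. -/
def IsGeodesicSegment (S : Set X) (a b : X) : Prop :=
  ∃ γ : ℝ → X, γ 0 = a ∧ γ (dist a b) = b ∧
    (∀ s ∈ Icc 0 (dist a b), ∀ t ∈ Icc 0 (dist a b), dist (γ s) (γ t) = |s - t|) ∧
    S = γ '' Icc 0 (dist a b)

/-- `X` is a `CAT(0)` space: any two points are joined by a geodesic segment, and geodesic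
triangles are not fatter than their comparison triangles in the Euclidean plane. The two points
`x`, `y` are taken on the two sides issuing from the vertex `p`; since the three vertices can be
permuted this covers any pair of sides. Neither properness nor completeness is required. -/
structure IsCAT0 (X : Type*) [MetricSpace X] : Prop where
  exists_geodesic : ∀ a b : X, ∃ S : Set X, IsGeodesicSegment S a b
  comparison : ∀ (p q r : X) (S T : Set X), IsGeodesicSegment S p q → IsGeodesicSegment T p r →
    ∀ p' q' r' : EuclideanSpace ℝ (Fin 2),
      dist p' q' = dist p q → dist q' r' = dist q r → dist p' r' = dist p r →
    ∀ x ∈ S, ∀ y ∈ T, ∀ x' ∈ segment ℝ p' q', ∀ y' ∈ segment ℝ p' r',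
      dist p' x' = dist p x → dist p' y' = dist p y → dist x y ≤ dist x' y'

/-- The set of points of `S` that minimize the distance to `x`. -/
def nearestPoints (S : Set X) (x : X) : Set X :=
  {p | p ∈ S ∧ ∀ q ∈ S, dist x p ≤ dist x q}

/-- `S` is `B`-contracting: every metric ball disjoint from `S` has projection to `S` of diameter
less than `B`. (Used for geodesic segments, which are bounded.) -/
def IsContracting (B : ℝ) (S : Set X) : Prop :=
  ∀ (z : X) (r : ℝ), Disjoint (Metric.ball z r) S →
    Metric.diam (⋃ x ∈ Metric.ball z r, nearestPoints S x) < B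

/-- Each of the two sets is contained in the `B`-neighbourhood of the other. -/
def HausdorffEquivalent (B : ℝ) (S T : Set X) : Prop :=
  S ⊆ Metric.thickening B T ∧ T ⊆ Metric.thickening B S

end Geodesics

section Actions

variable {Γ X : Type*} [Group Γ] [MetricSpace X] [MulAction Γ X]

/-- The element `g` acts on `X` as a rank 1 isometry (tested at the base point `x₀`, with orbit
points `xₙ = gⁿ x₀`). -/
def ActsAsRankOne (x₀ : X) (g : Γ) : Prop :=
  Tendsto (fun n : ℕ => dist (g ^ n • x₀) x₀) atTop atTop ∧
  ∃ B : ℝ, 0 < B ∧ ∀ n : ℕ, 0 < n →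
    (∃ S : Set X, IsGeodesicSegment S x₀ (g ^ n • x₀) ∧
      HausdorffEquivalent B S ((fun k : ℕ => g ^ k • x₀) '' Iic n)) ∧
    (∃ S : Set X, IsGeodesicSegment S x₀ (g ^ n • x₀) ∧ IsContracting B S)

/-- A group is virtually cyclic if it has a cyclic subgroup of finite index (finite groups
included). -/
def IsVirtuallyCyclic (G : Type*) [Group G] : Prop :=
  ∃ H : Subgroup G, IsCyclic H ∧ H.FiniteIndex

/-- Weak proper discontinuity of the action of `Γ` on `X`, tested at the base point `x₀`. -/
structure SatisfiesWPD (Γ : Type*) {X : Type*} [Group Γ] [MetricSpace X] [MulAction Γ X]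
    (x₀ : X) : Prop where
  not_virtuallyCyclic : ¬ IsVirtuallyCyclic Γ
  exists_rankOne : ∃ g : Γ, ActsAsRankOne x₀ g
  finite_of_rankOne : ∀ g : Γ, ActsAsRankOne x₀ g → ∀ c : ℝ, 0 < c → ∃ M : ℕ, 0 < M ∧
    {γ : Γ | dist x₀ (γ • x₀) ≤ c ∧ dist (g ^ M • x₀) (γ • g ^ M • x₀) ≤ c}.Finite

end Actions

section QuasiHomomorphisms

/-- A real function with bounded defect. -/
def IsQuasiHom {G : Type*} [Group G] (φ : G → ℝ) : Prop :=
  ∃ D : ℝ, ∀ x y : G, |φ (x * y) - φ x - φ y| ≤ D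

/-- The real vector space of homogeneous quasi-homomorphisms `G → ℝ`. -/
def homogeneousQuasiHom (G : Type*) [Group G] : Submodule ℝ (G → ℝ) where
  carrier := {φ | IsQuasiHom φ ∧ ∀ (g : G) (n : ℤ), φ (g ^ n) = n * φ g}
  zero_mem' := ⟨⟨0, fun x y => by simp⟩, fun g n => by simp⟩
  add_mem' := by
    rintro φ ψ ⟨⟨D, hD⟩, hφ⟩ ⟨⟨E, hE⟩, hψ⟩
    refine ⟨⟨D + E, fun x y => ?_⟩, fun g n => ?_⟩
    · have h1 := abs_le.1 (hD x y)
      have h2 := abs_le.1 (hE x y)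
      simp only [Pi.add_apply]
      exact abs_le.2 ⟨by linarith, by linarith⟩
    · simp only [Pi.add_apply, hφ, hψ]
      ring
  smul_mem' := by
    rintro a φ ⟨⟨D, hD⟩, hφ⟩
    refine ⟨⟨|a| * D, fun x y => ?_⟩, fun g n => ?_⟩
    · have h : (a • φ) (x * y) - (a • φ) x - (a • φ) y = a * (φ (x * y) - φ x - φ y) := by
        simp only [Pi.smul_apply, smul_eq_mul]
        ring
      rw [h, abs_mul]
      exact mul_le_mul_of_nonneg_left (hD x y) (abs_nonneg a)
    · simp only [Pi.smul_apply, smul_eq_mul, hφ]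
      ring

/-- The real vector space `Hom(G, ℝ)` of homomorphisms to the additive group of the reals. -/
def realHom (G : Type*) [Group G] : Submodule ℝ (G → ℝ) where
  carrier := {φ | ∀ x y : G, φ (x * y) = φ x + φ y}
  zero_mem' := fun x y => by simp
  add_mem' := by
    intro φ ψ hφ hψ x y
    simp only [Pi.add_apply, hφ x y, hψ x y]
    ring
  smul_mem' := by
    intro a φ hφ x y
    simp only [Pi.smul_apply, smul_eq_mul, hφ x y]
    ring

/-- Homogeneous quasi-homomorphisms modulo homomorphisms (every homomorphism is a homogeneous
quasi-homomorphism, see `realHom_le_homogeneousQuasiHom`). -/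
abbrev QHTilde (G : Type*) [Group G] : Type _ :=
  homogeneousQuasiHom G ⧸ (realHom G).submoduleOf (homogeneousQuasiHom G)

theorem realHom_le_homogeneousQuasiHom (G : Type*) [Group G] :
    realHom G ≤ homogeneousQuasiHom G := by
  intro φ hφ
  refine ⟨⟨0, fun x y => ?_⟩, fun g n => ?_⟩
  · rw [hφ x y]
    simp
  · let f : G →* Multiplicative ℝ := MonoidHom.mk' (fun x => Multiplicative.ofAdd (φ x)) hφ
    have h : φ (g ^ n) = n • φ g := congrArg Multiplicative.toAdd (map_zpow f g n)
    rw [h, zsmul_eq_mul]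

end QuasiHomomorphisms

/-!
Fix an element `g` that acts as a rank 1 isometry. By the contraction property of geodesics along its
orbit (the axis of `g`), a geodesic between points with distant projections to the axis has to pass
close to both projections. Let `κ p` be the exponent of an orbit point nearest to `p`, so that
`κ (h⁻¹ • p)` is the position of the projection to the translate of the axis by `h`. Let `E` be the
group of those elements that conjugate a nontrivial power of `g` to itself or to its inverse. WPD
shows that translates of the axis by elements outside of `E` have bounded projection to the axis,
whereas elements of `E` move the axis, as a set, a bounded distance; and that `E` is not the whole of `Γ`, as otherwise
the powers of `g` would have finite index. Together with the Behrstock inequality for two translates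
this is all that is needed of the geometry; it is recorded in `AxisSystem` and established in
`OrbitAxis.exists_axisSystem`.

Quasi-homomorphisms come from counting. A gate is a pair of sets `S`, `T`, thought of as the
points in front of it and the points behind it; a gate `h` precedes a gate `k` if every point is in
front of `k` or behind `h`. For an invariant family of gates let `c x y` be the largest length of a
chain of gates from `x` to `y`. If any two gates that separate the same two points are weakly ordered,
then for a triangle `x`, `y`, `z` the number `c x y` is, up to a bounded error, the sum of the largest
lengths of chains that separate `x` from `{y, z}` and of chains that separate `{x, z}` from `y`. Both
orientations of the triangle produce the same six numbers, whence `a ↦ c x₀ (a • x₀) - c (a • x₀) x₀` is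
a quasi-homomorphism (`isQuasiHom_gateFlow`).

For `t ∉ E` and a large integer `m` consider the element
`f = g ^ (8 * m) * t * g ^ (-4 * m) * t⁻¹ * g ^ (-6 * m) * t * g ^ (2 * m) * t⁻¹`, on which every
homomorphism to `ℝ` vanishes. A path along its powers follows translates of the axis over lengths
proportional to 8, 4, 6, 2, cyclically, and by the Behrstock inequality it has large projections to no
other translate. The gates used ask for a projection of length at least `7 * m` to one translate,
followed by one of length at least `3 * m` to the translate which is adjacent to it in this path. They
occur along the powers of `f`, do not occur in the reversed direction (where 8 is followed by 2), and
are too long to occur along the words of much smaller parameter. So the resulting homogeneous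
quasi-homomorphisms are triangular with respect to the words for a rapidly growing sequence of
parameters, and they are independent modulo homomorphisms (`not_finiteDimensional_QHTilde`).
-/

/-! ### Gates and the counting functions they define -/

section Gates

variable {H X : Type*}

/-- The gate `h`, with sides `S h` and `T h`, precedes the gate `k`: a point which has not yet
passed `h` is still in front of `k`. -/
def GatePrecedes (S T : H → Set X) (h k : H) : Prop :=
  ∀ p, p ∈ S k ∨ p ∈ T h

/-- The first `n` terms of `k` are consecutive gates, each of them separating `P` from `Q`. -/
structure IsGateChain (S T : H → Set X) (P Q : Set X) (n : ℕ) (k : ℕ → H) : Prop where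
  left : ∀ i < n, P ⊆ S (k i)
  right : ∀ i < n, Q ⊆ T (k i)
  precedes : ∀ i j, i < j → j < n → GatePrecedes S T (k i) (k j)

/-- The largest number of consecutive gates from `P` to `Q`. It is meaningful only when the lengths
of the gate chains from `P` to `Q` are bounded. -/
noncomputable def gateCount (S T : H → Set X) (P Q : Set X) : ℕ :=
  sSup {n | ∃ k, IsGateChain S T P Q n k}

/-- Two gates that both separate `x` from `y` are weakly ordered: no point has passed the second one
and is still in front of the first one. -/
def GatesComparable (S T : H → Set X) : Prop :=
  ∀ h k x y, x ∈ S h → x ∈ S k → y ∈ T h → y ∈ T k →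
    (∀ p, p ∈ T k → p ∉ S h) ∨ (∀ p, p ∈ T h → p ∉ S k)

/-- Any two points are separated by chains of gates of bounded length only. -/
def GatesFinite (S T : H → Set X) : Prop :=
  ∀ x y, ∃ m, ∀ n k, IsGateChain S T {x} {y} n k → n ≤ m

variable {S T : H → Set X}

theorem IsGateChain.mono {P P' Q Q' : Set X} {n : ℕ} {k : ℕ → H}
    (h : IsGateChain S T P Q n k) (hP : P' ⊆ P) (hQ : Q' ⊆ Q) : IsGateChain S T P' Q' n k :=
  ⟨fun i hi => hP.trans (h.left i hi), fun i hi => hQ.trans (h.right i hi), h.precedes⟩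

theorem IsGateChain.zero [Nonempty H] (P Q : Set X) :
    IsGateChain S T P Q 0 (fun _ => Classical.arbitrary H) :=
  ⟨by simp, by simp, by simp⟩

theorem GatesFinite.bddAbove (hfin : GatesFinite S T) {P Q : Set X} (hP : P.Nonempty)
    (hQ : Q.Nonempty) : BddAbove {n | ∃ k, IsGateChain S T P Q n k} := by
  obtain ⟨x, hx⟩ := hP
  obtain ⟨y, hy⟩ := hQ
  obtain ⟨m, hm⟩ := hfin x y
  refine ⟨m, ?_⟩
  rintro n ⟨k, hk⟩
  exact hm n k (hk.mono (by simpa using hx) (by simpa using hy))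

theorem IsGateChain.le_gateCount (hfin : GatesFinite S T) {P Q : Set X} (hP : P.Nonempty)
    (hQ : Q.Nonempty) {n : ℕ} {k : ℕ → H} (h : IsGateChain S T P Q n k) :
    n ≤ gateCount S T P Q :=
  le_csSup (hfin.bddAbove hP hQ) ⟨k, h⟩

theorem GatesFinite.exists_chain [Nonempty H] (hfin : GatesFinite S T) {P Q : Set X}
    (hP : P.Nonempty) (hQ : Q.Nonempty) : ∃ k, IsGateChain S T P Q (gateCount S T P Q) k :=
  Nat.sSup_mem (s := {n | ∃ k, IsGateChain S T P Q n k}) ⟨0, _, IsGateChain.zero P Q⟩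
    (hfin.bddAbove hP hQ)

/-- A third point `z` cuts a chain of gates from `x` to `y` into a part that it has passed and a
part that it has not passed, with at most one gate in between. -/
theorem gateCount_le_split [Nonempty H] (hfin : GatesFinite S T) (x y z : X) :
    gateCount S T {x} {y} ≤ gateCount S T {x} {y, z} + gateCount S T {x, z} {y} + 1 := by
  classical
  obtain ⟨k, hk⟩ := hfin.exists_chain (singleton_nonempty x) (singleton_nonempty y)
  set n := gateCount S T {x} {y}
  have hex : ∃ j, j ≤ n ∧ ∀ i, j ≤ i → i < n → z ∈ S (k i) :=
    ⟨n, le_rfl, fun i h1 h2 => absurd h1 (by omega)⟩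
  obtain ⟨hj, hjS⟩ := Nat.find_spec hex
  have hmin := fun i (hi : i < Nat.find hex) => Nat.find_min hex hi
  set j := Nat.find hex
  have h1 : IsGateChain S T {x} {y, z} (j - 1) k := by
    refine ⟨fun i hi => hk.left i (by omega), fun i hi => ?_,
      fun a b hab hb => hk.precedes a b hab (by omega)⟩
    have hz : z ∉ S (k (j - 1)) := by
      intro hz
      apply hmin (j - 1) (by omega)
      refine ⟨by omega, fun a ha han => ?_⟩
      rcases Nat.eq_or_lt_of_le ha with h | h
      · rwa [← h]
      · exact hjS a (by omega) han
    rintro p (rfl | rfl)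
    · exact hk.right i (by omega) rfl
    · exact (hk.precedes i (j - 1) (by omega) (by omega) p).resolve_left hz
  have h2 : IsGateChain S T {x, z} {y} (n - j) (fun i => k (j + i)) := by
    refine ⟨fun i hi => ?_, fun i hi => hk.right _ (by omega),
      fun a b hab hb => hk.precedes _ _ (by omega) (by omega)⟩
    rintro p (rfl | rfl)
    · exact hk.left _ (by omega) rfl
    · exact hjS _ (by omega) (by omega)
  have h3 := h1.le_gateCount hfin (by simp) (by simp)
  have h4 := h2.le_gateCount hfin (by simp) (by simp)
  omega

theorem gateCount_split_le [Nonempty H] (hfin : GatesFinite S T) (hcomp : GatesComparable S T)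
    (x y z : X) :
    gateCount S T {x} {y, z} + gateCount S T {x, z} {y} ≤ gateCount S T {x} {y} + 2 := by
  obtain ⟨k, hk⟩ := hfin.exists_chain (P := {x}) (Q := {y, z}) (by simp) (by simp)
  obtain ⟨l, hl⟩ := hfin.exists_chain (P := {x, z}) (Q := {y}) (by simp) (by simp)
  set a := gateCount S T {x} {y, z}
  set b := gateCount S T {x, z} {y}
  have ha := (hk.mono (P' := {x}) (Q' := {y}) (by simp) (by simp)).le_gateCount hfin
    (by simp) (by simp)
  have hb := (hl.mono (P' := {x}) (Q' := {y}) (by simp) (by simp)).le_gateCount hfin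
    (by simp) (by simp)
  rcases Nat.eq_zero_or_pos a with ha0 | ha0
  · omega
  rcases Nat.eq_zero_or_pos b with hb0 | hb0
  · omega
  -- the point `z` has passed the last gate of `k`, and is in front of the first gate of `l`
  have key : ∀ p, p ∈ T (l 0) → p ∉ S (k (a - 1)) := by
    rcases hcomp (k (a - 1)) (l 0) x y (hk.left _ (by omega) (by simp))
      (hl.left _ (by omega) (by simp)) (hk.right _ (by omega) (by simp))
      (hl.right _ (by omega) (by simp)) with h | h
    · exact h
    · exact absurd (hl.left 0 hb0 (by simp)) (h z (hk.right _ (by omega) (by simp)))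
  have h : IsGateChain S T {x} {y} ((a - 1) + (b - 1))
      (fun i => if i < a - 1 then k i else l (i - (a - 1) + 1)) := by
    refine ⟨fun i hi => ?_, fun i hi => ?_, fun i j hij hj p => ?_⟩
    · split_ifs with h
      · exact hk.left _ (by omega)
      · exact Subset.trans (by simp) (hl.left _ (by omega))
    · split_ifs with h
      · exact Subset.trans (by simp) (hk.right _ (by omega))
      · exact hl.right _ (by omega)
    · by_cases h1 : i < a - 1 <;> by_cases h2 : j < a - 1
      · simpa [h1, h2] using hk.precedes i j hij (by omega) p
      · simp only [h1, h2, if_true, if_false]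
        rcases hl.precedes 0 (j - (a - 1) + 1) (by omega) (by omega) p with h | h
        · exact Or.inl h
        · exact Or.inr ((hk.precedes i (a - 1) h1 (by omega) p).resolve_left (key p h))
      · omega
      · simpa [h1, h2] using
          hl.precedes (i - (a - 1) + 1) (j - (a - 1) + 1) (by omega) (by omega) p
  have h3 := h.le_gateCount hfin (by simp) (by simp)
  omega

/-- The antisymmetrized count of gates. -/
noncomputable def gateFlow (S T : H → Set X) (x y : X) : ℤ :=
  gateCount S T {x} {y} - gateCount S T {y} {x}

/-- Up to a bounded error, both orientations of a triangle decompose into the same six counts, so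
that the antisymmetrized count is a bounded distance from a cocycle. -/
theorem abs_gateFlow_add_le [Nonempty H] (hfin : GatesFinite S T) (hcomp : GatesComparable S T)
    (x y z : X) : |gateFlow S T x z - gateFlow S T x y - gateFlow S T y z| ≤ 9 := by
  have u := gateCount_le_split hfin
  have l := gateCount_split_le hfin hcomp
  have := u x y z; have := u y z x; have := u z x y
  have := u y x z; have := u z y x; have := u x z y
  have := l x y z; have := l y z x; have := l z x y
  have := l y x z; have := l z y x; have := l x z y
  simp only [pair_comm y x, pair_comm z x, pair_comm z y] at *
  simp only [gateFlow]
  rw [abs_le]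
  constructor <;> omega

end Gates

section Equivariance

variable {Γ X : Type*} [Group Γ] [MulAction Γ X]

/-- The family of translates of a subset. -/
def translates (Γ : Type*) [Group Γ] [MulAction Γ X] (S : Set X) (h : Γ) : Set X :=
  {p | h⁻¹ • p ∈ S}

theorem gateCount_smul (S T : Set X) (a : Γ) (x y : X) :
    gateCount (translates Γ S) (translates Γ T) {a • x} {a • y} =
      gateCount (translates Γ S) (translates Γ T) {x} {y} := by
  have key : ∀ (a : Γ) (x y : X) (n : ℕ) (k : ℕ → Γ),
      IsGateChain (translates Γ S) (translates Γ T) {x} {y} n k →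
      IsGateChain (translates Γ S) (translates Γ T) {a • x} {a • y} n (fun i => a * k i) := by
    intro a x y n k h
    refine ⟨fun i hi => ?_, fun i hi => ?_, fun i j hij hj p => ?_⟩
    · simpa [translates, mul_smul] using h.left i hi
    · simpa [translates, mul_smul] using h.right i hi
    · simpa [translates, mul_smul] using h.precedes i j hij hj (a⁻¹ • p)
  unfold gateCount
  congr 1
  ext n
  constructor
  · rintro ⟨k, hk⟩
    exact ⟨_, by simpa using key a⁻¹ _ _ n k hk⟩
  · rintro ⟨k, hk⟩
    exact ⟨_, key a _ _ n k hk⟩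

theorem isQuasiHom_gateFlow {S T : Set X}
    (hfin : GatesFinite (translates Γ S) (translates Γ T))
    (hcomp : GatesComparable (translates Γ S) (translates Γ T)) (x₀ : X) :
    IsQuasiHom (fun a : Γ =>
      (gateFlow (translates Γ S) (translates Γ T) x₀ (a • x₀) : ℝ)) := by
  refine ⟨9, fun a b => ?_⟩
  have h := abs_gateFlow_add_le hfin hcomp x₀ (a • x₀) ((a * b) • x₀)
  have h2 : gateFlow (translates Γ S) (translates Γ T) (a • x₀) ((a * b) • x₀) =
      gateFlow (translates Γ S) (translates Γ T) x₀ (b • x₀) := by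
    simp only [gateFlow, mul_smul, gateCount_smul]
  rw [h2] at h
  dsimp only
  exact_mod_cast h

end Equivariance

/-! ### Homogeneous quasi-homomorphisms -/

section Homogenization

variable {G : Type*} [Group G]

/-- Homogenization: the limit of `q (x ^ n) / n` is a homogeneous quasi-homomorphism at a bounded
distance from `q`. -/
theorem IsQuasiHom.exists_homogeneous {q : G → ℝ} (hq : IsQuasiHom q) :
    ∃ φ ∈ homogeneousQuasiHom G, ∃ C, ∀ x, |φ x - q x| ≤ C := by
  obtain ⟨D, hD⟩ := hq
  have hD0 : 0 ≤ D := (abs_nonneg _).trans (hD 1 1)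
  -- `q (x ^ n)` is `n * q x` up to an error which is linear in `n`
  have hpow : ∀ (x : G) (n : ℕ), 0 < n → |q (x ^ n) - n * q x| ≤ n * D := by
    intro x n hn
    induction n, hn using Nat.le_induction with
    | base => simpa using hD0
    | succ n hn ih =>
      have h1 := abs_le.1 (hD (x ^ n) x)
      have h2 := abs_le.1 ih
      rw [← pow_succ] at h1
      push_cast
      rw [abs_le]
      constructor <;> nlinarith
  have hcauchy : ∀ x, CauchySeq (fun n : ℕ => q (x ^ (n + 1)) / ((n + 1 : ℕ) : ℝ)) := by
    intro x
    have hmn : ∀ m n : ℕ, 0 < m → 0 < n → |q (x ^ m) / m - q (x ^ n) / n| ≤ D / m + D / n := by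
      intro m n hm hn
      have h1 := hpow (x ^ m) n hn
      have h2 := hpow (x ^ n) m hm
      rw [← pow_mul] at h1 h2
      rw [mul_comm n m] at h2
      have hm' : (0 : ℝ) < m := by exact_mod_cast hm
      have hn' : (0 : ℝ) < n := by exact_mod_cast hn
      have h3 : q (x ^ m) / m - q (x ^ n) / n =
          (n * q (x ^ m) - m * q (x ^ n)) / (m * n) := by
        field_simp
      have h4 : D / m + D / n = (n * D + m * D) / (m * n) := by
        field_simp
      rw [h3, h4, abs_div, abs_of_pos (mul_pos hm' hn')]
      gcongr
      rw [abs_le] at *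
      constructor <;> linarith
    rw [Metric.cauchySeq_iff']
    intro ε hε
    obtain ⟨N, hN⟩ := exists_nat_gt (2 * D / ε)
    refine ⟨N, fun n hn => ?_⟩
    rw [Real.dist_eq]
    refine (hmn (n + 1) (N + 1) (by omega) (by omega)).trans_lt ?_
    have hN' : 2 * D / ε < ((N + 1 : ℕ) : ℝ) := by push_cast; linarith
    have hpos : (0 : ℝ) < ((N + 1 : ℕ) : ℝ) := by positivity
    have h5 : D / ((n + 1 : ℕ) : ℝ) ≤ D / ((N + 1 : ℕ) : ℝ) := by
      gcongr
    have h6 : 2 * D / ((N + 1 : ℕ) : ℝ) < ε := by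
      rw [div_lt_iff₀ hpos]
      rw [div_lt_iff₀ hε] at hN'
      linarith
    calc _ ≤ D / ((N + 1 : ℕ) : ℝ) + D / ((N + 1 : ℕ) : ℝ) := by gcongr
      _ = 2 * D / ((N + 1 : ℕ) : ℝ) := by ring
      _ < ε := h6
  choose φ hφ using fun x => cauchySeq_tendsto_of_complete (hcauchy x)
  have hclose : ∀ x, |φ x - q x| ≤ D := by
    intro x
    refine le_of_tendsto ((hφ x).sub_const (q x)).abs (Eventually.of_forall fun n => ?_)
    have hpos : (0 : ℝ) < ((n + 1 : ℕ) : ℝ) := by positivity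
    have h := hpow x (n + 1) (by omega)
    have h3 : q (x ^ (n + 1)) / ((n + 1 : ℕ) : ℝ) - q x =
        (q (x ^ (n + 1)) - ((n + 1 : ℕ) : ℝ) * q x) / ((n + 1 : ℕ) : ℝ) := by
      field_simp
    rw [h3, abs_div, abs_of_pos hpos, div_le_iff₀ hpos]
    linarith
  have hquasi : ∀ x y, |φ (x * y) - φ x - φ y| ≤ 4 * D := by
    intro x y
    have h1 := abs_le.1 (hclose x)
    have h2 := abs_le.1 (hclose y)
    have h3 := abs_le.1 (hclose (x * y))
    have h4 := abs_le.1 (hD x y)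
    rw [abs_le]
    constructor <;> linarith
  have hnat : ∀ (x : G) (m : ℕ), φ (x ^ m) = m * φ x := by
    intro x m
    rcases Nat.eq_zero_or_pos m with rfl | hm
    · -- on the trivial element the sequence is `q 1 / (n + 1)`
      have h := hφ 1
      simp only [one_pow] at h
      have h0 : Tendsto (fun n : ℕ => q 1 / ((n + 1 : ℕ) : ℝ)) atTop (𝓝 0) :=
        (tendsto_const_div_atTop_nhds_zero_nat (q 1)).comp (tendsto_add_atTop_nat 1)
      simpa using tendsto_nhds_unique h h0
    have h1 : Tendsto (fun n : ℕ => q (x ^ (m * (n + 1))) / ((m * (n + 1) : ℕ) : ℝ)) atTop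
        (𝓝 (φ x)) := by
      have hsub : Tendsto (fun n : ℕ => m * (n + 1) - 1) atTop atTop := by
        refine tendsto_atTop_mono (fun n => ?_) tendsto_id
        have : 1 * (n + 1) ≤ m * (n + 1) := Nat.mul_le_mul_right _ hm
        simp only [id]
        omega
      refine ((hφ x).comp hsub).congr fun n => ?_
      have : m * (n + 1) - 1 + 1 = m * (n + 1) := Nat.sub_add_cancel (Nat.mul_pos hm (by omega))
      simp only [Function.comp, this]
    have h2 := (hφ (x ^ m)).const_mul ((m : ℝ)⁻¹)
    have h3 : (m : ℝ)⁻¹ * φ (x ^ m) = φ x := by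
      refine tendsto_nhds_unique h2 (h1.congr fun n => ?_)
      rw [pow_mul]
      push_cast
      field_simp
    have hm' : (m : ℝ) ≠ 0 := by exact_mod_cast hm.ne'
    rw [← h3]
    field_simp
  have hinv : ∀ x, φ x⁻¹ = -φ x := by
    intro x
    -- homogeneity for positive exponents improves a bound on `φ x + φ x⁻¹` to equality
    by_contra hne
    have hpos : 0 < |φ x⁻¹ + φ x| := abs_pos.2 fun h => hne (by linarith)
    obtain ⟨m, hm⟩ := exists_nat_gt (4 * D / |φ x⁻¹ + φ x|)
    rw [div_lt_iff₀ hpos] at hm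
    have h1 := hquasi (x ^ m) (x⁻¹ ^ m)
    have h0 : φ 1 = 0 := by simpa using hnat 1 0
    rw [inv_pow, mul_inv_cancel, ← inv_pow, hnat, hnat, h0] at h1
    have h2 : (0 : ℝ) - m * φ x - m * φ x⁻¹ = -(m * (φ x⁻¹ + φ x)) := by ring
    rw [h2, abs_neg, abs_mul, Nat.abs_cast] at h1
    linarith
  refine ⟨φ, ⟨⟨4 * D, hquasi⟩, fun x n => ?_⟩, D, hclose⟩
  obtain ⟨m, rfl | rfl⟩ := n.eq_nat_or_neg
  · simpa using hnat x m
  · simp [hinv, hnat]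

theorem eq_zero_of_bounded_on_powers {φ : G → ℝ} (hφ : φ ∈ homogeneousQuasiHom G) {f : G} {C : ℝ}
    (h : ∀ n : ℕ, |φ (f ^ n)| ≤ C) : φ f = 0 := by
  by_contra hne
  have hpos : 0 < |φ f| := abs_pos.2 hne
  obtain ⟨m, hm⟩ := exists_nat_gt (C / |φ f|)
  rw [div_lt_iff₀ hpos] at hm
  have h1 := h m
  have h2 := hφ.2 f m
  rw [zpow_natCast] at h2
  rw [h2, abs_mul, Int.cast_natCast, Nat.abs_cast] at h1
  linarith

/-- Homogeneous quasi-homomorphisms that are triangular with respect to a sequence of elements on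
which all homomorphisms vanish are independent modulo homomorphisms. -/
theorem not_finiteDimensional_QHTilde {φ : ℕ → G → ℝ} {f : ℕ → G}
    (hφ : ∀ i, φ i ∈ homogeneousQuasiHom G) (hdiag : ∀ i, φ i (f i) ≠ 0)
    (htri : ∀ i j, j < i → φ i (f j) = 0) (hf : ∀ j, ∀ ψ ∈ realHom G, ψ (f j) = 0) :
    ¬ FiniteDimensional ℝ (QHTilde G) := by
  intro hfd
  let v : ℕ → QHTilde G := fun i => Submodule.Quotient.mk ⟨φ i, hφ i⟩
  have hli : LinearIndependent ℝ v := by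
    rw [linearIndependent_iff']
    intro s a hs
    have hmem : (∑ i ∈ s, a i • φ i) ∈ realHom G := by
      have h1 : (Submodule.Quotient.mk (∑ i ∈ s, a i • (⟨φ i, hφ i⟩ : homogeneousQuasiHom G)) :
          QHTilde G) = 0 := by
        rw [← hs, ← Submodule.mkQ_apply, map_sum]
        rfl
      rw [Submodule.Quotient.mk_eq_zero, Submodule.submoduleOf, Submodule.mem_comap] at h1
      simpa using h1
    intro j
    induction j using Nat.strong_induction_on with
    | _ j ih =>
      intro hj
      have h := hf j _ hmem
      rw [Finset.sum_apply, Finset.sum_eq_single j] at h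
      · exact (mul_eq_zero.1 h).resolve_right (hdiag j)
      · intro i hi hij
        rcases lt_or_gt_of_ne hij with h1 | h1
        · simp [ih i h1 hi]
        · simp [htri i j h1]
      · exact fun h1 => absurd hj h1
  exact Infinite.not_finite (α := ℕ) hli.finite

end Homogenization

/-! ### Words across distinct axes -/

section AxisSystems

variable {Γ X : Type*} [Group Γ] [MulAction Γ X]

/-- The data that remain of the geometry. The integer `κ p` is the position of the projection of `p`
to the orbit of `x₀` under the powers of `g` (the axis); `κ (h⁻¹ • p)` is then the position of the
projection to the translate of the axis by `h`. The subgroup `E` is the coarse stabilizer of the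
axis, and `t` is an element outside of it. All errors are at most `R`. -/
structure AxisSystem (g t : Γ) (x₀ : X) (E : Subgroup Γ) (κ : X → ℤ) (R : ℤ) : Prop where
  one_le : 1 ≤ R
  smul : ∀ p, κ (g • p) = κ p + 1
  base : κ x₀ = 0
  mem : g ∈ E
  notMem : t ∉ E
  jump : ∀ h : Γ, |κ (h • t • x₀) - κ (h • x₀)| ≤ R
  bounded : ∀ h ∉ E, ∀ e ∈ E, |κ ((h * e) • x₀) - κ (h • x₀)| ≤ R
  behrstock : ∀ h ∉ E, ∀ p, |κ p - κ (h • x₀)| ≤ R ∨ |κ (h⁻¹ • p) - κ (h⁻¹ • x₀)| ≤ R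
  stabilizer : ∀ h ∈ E, ∃ ε c : ℤ, (ε = 1 ∨ ε = -1) ∧ ∀ p, |κ (h⁻¹ • p) - ε * κ p - c| ≤ R
  path : ∀ x y : X, ∃ (m : ℕ) (p : ℕ → X), p 0 = x ∧ p m = y ∧
    ∀ i < m, ∀ h : Γ, |κ (h • p i) - κ (h • p (i + 1))| ≤ R

/-- The prefixes of the infinite word `g ^ e 0 * s 0 * g ^ e 1 * s 1 * ⋯`. -/
def wordPrefix (g : Γ) (e : ℕ → ℤ) (s : ℕ → Γ) : ℕ → Γ
  | 0 => 1
  | i + 1 => wordPrefix g e s i * g ^ e i * s i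

theorem coord_zpow_smul {g : Γ} {κ : X → ℤ} (hκ : ∀ p, κ (g • p) = κ p + 1) (n : ℤ) (p : X) :
    κ (g ^ n • p) = κ p + n := by
  induction n using Int.induction_on generalizing p with
  | zero => simp
  | succ n ih => rw [zpow_add_one, mul_smul, ih, hκ]; ring
  | pred n ih =>
    have h := hκ (g⁻¹ • p)
    rw [smul_inv_smul] at h
    rw [zpow_sub_one, mul_smul, ih]
    linarith

namespace AxisSystem

variable {g t : Γ} {x₀ : X} {E : Subgroup Γ} {κ : X → ℤ} {R : ℤ}

/-- The Behrstock inequality for two translates of the axis. -/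
theorem behrstock' (A : AxisSystem g t x₀ E κ R) {h k : Γ} (hk : h⁻¹ * k ∉ E) (p : X) :
    |κ (h⁻¹ • p) - κ (h⁻¹ • k • x₀)| ≤ R ∨ |κ (k⁻¹ • p) - κ (k⁻¹ • h • x₀)| ≤ R := by
  have := A.behrstock _ hk (h⁻¹ • p)
  simpa [mul_smul] using this

section Words

variable {e : ℕ → ℤ} {s : ℕ → Γ}

theorem step_notMem (A : AxisSystem g t x₀ E κ R) (hs : ∀ i, s i = t ∨ s i = t⁻¹) (i : ℕ) :
    (wordPrefix g e s i)⁻¹ * wordPrefix g e s (i + 1) ∉ E := by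
  have h1 : (wordPrefix g e s i)⁻¹ * wordPrefix g e s (i + 1) = g ^ e i * s i := by
    simp [wordPrefix, mul_assoc]
  rw [h1, E.mul_mem_cancel_left (E.zpow_mem A.mem _)]
  rcases hs i with h | h <;> simp [h, A.notMem]

theorem jump_step (A : AxisSystem g t x₀ E κ R) (hs : ∀ i, s i = t ∨ s i = t⁻¹) (i : ℕ) (h : Γ) :
    |κ (h • s i • x₀) - κ (h • x₀)| ≤ R := by
  rcases hs i with h1 | h1
  · rw [h1]; exact A.jump h
  · have := A.jump (h * t⁻¹)
    rw [abs_sub_comm] at this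
    simpa [mul_smul, h1] using this

theorem coord_next (A : AxisSystem g t x₀ E κ R) (hs : ∀ i, s i = t ∨ s i = t⁻¹) (i : ℕ) :
    |κ ((wordPrefix g e s i)⁻¹ • wordPrefix g e s (i + 1) • x₀) - e i| ≤ R := by
  have h1 : (wordPrefix g e s i)⁻¹ • wordPrefix g e s (i + 1) • x₀ = g ^ e i • s i • x₀ := by
    simp [wordPrefix, mul_smul]
  have h2 := A.jump_step hs i 1
  rw [h1, coord_zpow_smul A.smul]
  simpa [A.base] using h2

theorem coord_prev (A : AxisSystem g t x₀ E κ R) (hs : ∀ i, s i = t ∨ s i = t⁻¹) (i : ℕ) :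
    |κ ((wordPrefix g e s (i + 1))⁻¹ • wordPrefix g e s i • x₀)| ≤ 2 * R := by
  have h1 : (wordPrefix g e s (i + 1))⁻¹ • wordPrefix g e s i • x₀ =
      ((s i)⁻¹ * g ^ (-e i)) • x₀ := by
    simp [wordPrefix, mul_smul]
  have hn : (s i)⁻¹ ∉ E := by
    rcases hs i with h | h <;> simp [h, A.notMem]
  have h2 := A.bounded _ hn _ (E.zpow_mem A.mem (-e i))
  have h3 := A.jump_step hs i (s i)⁻¹
  rw [inv_smul_smul, A.base] at h3
  rw [h1]
  rw [abs_le] at *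
  constructor <;> linarith

theorem behrstock_step (A : AxisSystem g t x₀ E κ R) (hs : ∀ i, s i = t ∨ s i = t⁻¹) (i : ℕ)
    (p : X) : |κ ((wordPrefix g e s i)⁻¹ • p) - e i| ≤ 2 * R ∨
      |κ ((wordPrefix g e s (i + 1))⁻¹ • p)| ≤ 3 * R := by
  have h1 := A.coord_next (e := e) hs i
  have h2 := A.coord_prev (e := e) hs i
  rcases A.behrstock' (A.step_notMem (e := e) hs i) p with h | h
  · left
    rw [abs_le] at *
    constructor <;> linarith
  · right
    rw [abs_le] at *
    constructor <;> linarith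

/-- A point that has entered an axis of the word has traversed all earlier axes: the local
information of `behrstock_step` propagates, since the exponents are large. -/
theorem coord_of_entered (A : AxisSystem g t x₀ E κ R) (hs : ∀ i, s i = t ∨ s i = t⁻¹)
    (he : ∀ i, 20 * R < |e i|) {j : ℕ} {p : X} (hp : 3 * R < |κ ((wordPrefix g e s j)⁻¹ • p)|)
    {i : ℕ} (hij : i < j) : |κ ((wordPrefix g e s i)⁻¹ • p) - e i| ≤ 2 * R := by
  induction j with
  | zero => omega
  | succ j ih =>
    have h := (A.behrstock_step hs j p).resolve_right (not_le.2 hp)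
    rcases Nat.lt_succ_iff_lt_or_eq.1 hij with h1 | rfl
    · refine ih ?_ h1
      have := he j
      have := A.one_le
      have h3 : |e j| ≤ |κ ((wordPrefix g e s j)⁻¹ • p)| +
          |κ ((wordPrefix g e s j)⁻¹ • p) - e j| := by
        rw [abs_sub_comm]
        have := abs_add_le (κ ((wordPrefix g e s j)⁻¹ • p)) (e j - κ ((wordPrefix g e s j)⁻¹ • p))
        simpa using this
      linarith
    · exact h

theorem coord_of_lt (A : AxisSystem g t x₀ E κ R) (hs : ∀ i, s i = t ∨ s i = t⁻¹)
    (he : ∀ i, 20 * R < |e i|) {i j : ℕ} (hij : i < j) :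
    |κ ((wordPrefix g e s i)⁻¹ • wordPrefix g e s j • x₀) - e i| ≤ 2 * R := by
  obtain ⟨j, rfl⟩ : ∃ l, j = l + 1 := ⟨j - 1, by omega⟩
  have h := A.coord_next (e := e) hs j
  have hR := A.one_le
  rcases Nat.lt_succ_iff_lt_or_eq.1 hij with h1 | rfl
  · refine A.coord_of_entered hs he ?_ h1
    have := he j
    rw [lt_abs] at *
    rw [abs_le] at h
    rcases this with h2 | h2
    · left; linarith
    · right; linarith
  · linarith

theorem coord_of_le (A : AxisSystem g t x₀ E κ R) (hs : ∀ i, s i = t ∨ s i = t⁻¹)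
    (he : ∀ i, 20 * R < |e i|) {i j : ℕ} (hij : j ≤ i) :
    |κ ((wordPrefix g e s i)⁻¹ • wordPrefix g e s j • x₀)| ≤ 3 * R := by
  have hR := A.one_le
  rcases hij.eq_or_lt with rfl | h
  · rw [inv_smul_smul, A.base]
    simp
    linarith
  · by_contra hne
    have h1 := A.coord_of_entered hs he (not_le.1 hne) h
    rw [inv_smul_smul, A.base, zero_sub, abs_neg] at h1
    have := he j
    linarith

/-- The path described by a word has large projections only to the axes that it follows. -/
theorem displacement_le (A : AxisSystem g t x₀ E κ R) (hs : ∀ i, s i = t ∨ s i = t⁻¹)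
    (he : ∀ i, 20 * R < |e i|) (h : Γ) (n : ℕ) :
    |κ (h⁻¹ • x₀) - κ (h⁻¹ • wordPrefix g e s n • x₀)| ≤ 4 * R ∨
      ∃ i < n, (wordPrefix g e s i)⁻¹ * h ∈ E ∧
        |κ (h⁻¹ • x₀) - κ (h⁻¹ • wordPrefix g e s n • x₀)| ≤ |e i| + 7 * R := by
  have hR := A.one_le
  have h0 : ∀ i, |κ ((wordPrefix g e s i)⁻¹ • x₀)| ≤ 3 * R := fun i => by
    simpa [wordPrefix] using A.coord_of_le hs he (Nat.zero_le i)
  by_cases hex : ∃ i < n, (wordPrefix g e s i)⁻¹ * h ∈ E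
  · right
    obtain ⟨i, hi, hE⟩ := hex
    refine ⟨i, hi, hE, ?_⟩
    obtain ⟨ε, c, hε, hc⟩ := A.stabilizer _ hE
    have h1 := hc ((wordPrefix g e s i)⁻¹ • x₀)
    have h2 := hc ((wordPrefix g e s i)⁻¹ • wordPrefix g e s n • x₀)
    have h3 := A.coord_of_lt hs he hi
    have h4 := h0 i
    simp only [mul_inv_rev, inv_inv, mul_smul, smul_inv_smul] at h1 h2
    have h5 := neg_abs_le (e i)
    have h6 := le_abs_self (e i)
    rcases hε with rfl | rfl <;>
    · rw [abs_le] at *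
      constructor <;> linarith
  · left
    push Not at hex
    have hex' : ∀ i < n, h⁻¹ * wordPrefix g e s i ∉ E := fun i hi hmem => hex i hi (by
      simpa using E.inv_mem hmem)
    set a : ℕ → ℤ := fun i => κ (h⁻¹ • wordPrefix g e s i • x₀) with ha
    have ha0 : κ (h⁻¹ • x₀) = a 0 := by simp [ha, wordPrefix]
    have hstep : ∀ i < n, |a (i + 1) - a i| ≤ 2 * R := by
      intro i hi
      have h1 := A.bounded _ (hex' i hi) _ (E.zpow_mem A.mem (e i))
      have h2 := A.jump_step hs i (h⁻¹ * wordPrefix g e s i * g ^ e i)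
      simp only [mul_smul] at h1 h2
      simp only [ha, wordPrefix, mul_smul]
      rw [abs_le] at *
      constructor <;> linarith
    have hside : ∀ i < n, |a 0 - a i| ≤ R ∨ |a n - a i| ≤ R := by
      intro i hi
      rcases A.behrstock' (hex' i hi) x₀ with h1 | h1
      · left; rwa [← ha0]
      rcases A.behrstock' (hex' i hi) (wordPrefix g e s n • x₀) with h2 | h2
      · right; exact h2
      exfalso
      have h3 := A.coord_of_lt hs he hi
      have h4 := h0 i
      have h5 := he i
      rw [lt_abs] at h5
      rw [abs_le] at *
      rcases h5 with h5 | h5 <;> linarith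
    rw [ha0]
    change |a 0 - a n| ≤ 4 * R
    rcases Nat.eq_zero_or_pos n with rfl | hn
    · simp; linarith
    have hfwd : ∀ i < n, |a 0 - a i| ≤ R ∨ |a 0 - a n| ≤ 4 * R := by
      intro i
      induction i with
      | zero => intro _; left; simp; linarith
      | succ i ih =>
        intro hi
        rcases ih (by omega) with h1 | h1
        · rcases hside (i + 1) hi with h2 | h2
          · exact Or.inl h2
          · right
            have h3 := hstep i (by omega)
            rw [abs_le] at *
            constructor <;> linarith
        · exact Or.inr h1
    rcases hfwd (n - 1) (by omega) with h1 | h1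
    · have h2 := hstep (n - 1) (by omega)
      rw [Nat.sub_add_cancel hn] at h2
      rw [abs_le] at *
      constructor <;> linarith
    · exact h1

end Words

/-! ### The gates that detect a word -/

/-- The points in front of a long part of the axis. -/
def gateSource (κ : X → ℤ) (R : ℤ) : Set X := {p | κ p ≤ 4 * R}

/-- The points beyond a part of the axis of length about `8 * m`, and then beyond a part of length
about `4 * m`, in the negative direction, of the next axis on the path of `detectingWord`. -/
def gateTarget (g t : Γ) (κ : X → ℤ) (m : ℤ) : Set X :=
  {p | 7 * m ≤ κ p ∧ κ ((g ^ (8 * m) * t)⁻¹ • p) ≤ -3 * m}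

/-- The exponents of the detecting word. Their sum over a period vanishes, so that homomorphisms to
`ℝ` vanish on the word; and read cyclically, an exponent of absolute value at least `7 * m` is followed immediately by one of
absolute value at least `3 * m` in the given order, but not in the reversed order. -/
def detectingExponent (m : ℤ) (i : ℕ) : ℤ :=
  if i % 4 = 0 then 8 * m else if i % 4 = 1 then -4 * m else if i % 4 = 2 then -6 * m else 2 * m

/-- The letters `t` and `t⁻¹` alternately. -/
def detectingLetter (t : Γ) (i : ℕ) : Γ := if i % 2 = 0 then t else t⁻¹

/-- The prefixes of the periodic word with the detecting exponents. -/
def detectingPrefix (g t : Γ) (m : ℤ) : ℕ → Γ :=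
  wordPrefix g (detectingExponent m) (detectingLetter t)

/-- The word `g ^ (8 * m) * t * g ^ (-4 * m) * t⁻¹ * g ^ (-6 * m) * t * g ^ (2 * m) * t⁻¹`. -/
def detectingWord (g t : Γ) (m : ℤ) : Γ := detectingPrefix g t m 4

theorem detectingLetter_eq (t : Γ) (i : ℕ) :
    detectingLetter t i = t ∨ detectingLetter t i = t⁻¹ := by
  unfold detectingLetter
  split_ifs <;> simp

theorem detectingExponent_cases (m : ℤ) (i : ℕ) :
    (i % 4 = 0 ∧ detectingExponent m i = 8 * m) ∨ (i % 4 = 1 ∧ detectingExponent m i = -4 * m) ∨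
    (i % 4 = 2 ∧ detectingExponent m i = -6 * m) ∨ (i % 4 = 3 ∧ detectingExponent m i = 2 * m) := by
  unfold detectingExponent
  split_ifs <;> omega

theorem lt_abs_detectingExponent {m : ℤ} (hR : 1 ≤ R) (hm : 100 * R ≤ m) (i : ℕ) :
    20 * R < |detectingExponent m i| := by
  rw [lt_abs]
  rcases detectingExponent_cases m i with h | h | h | h <;> rw [h.2] <;> omega

theorem detectingPrefix_add_four (g t : Γ) (m : ℤ) (i : ℕ) :
    detectingPrefix g t m (i + 4) = detectingWord g t m * detectingPrefix g t m i := by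
  induction i with
  | zero => simp [detectingWord, detectingPrefix, wordPrefix]
  | succ i ih =>
    have h1 : detectingExponent m (i + 4) = detectingExponent m i := by
      simp [detectingExponent]
    have h2 : detectingLetter t (i + 4) = detectingLetter t i := by
      have : (i + 4) % 2 = i % 2 := by omega
      simp [detectingLetter, this]
    have h3 : detectingPrefix g t m (i + 1 + 4) = detectingPrefix g t m (i + 4) *
        g ^ detectingExponent m (i + 4) * detectingLetter t (i + 4) := rfl
    have h4 : detectingPrefix g t m (i + 1) = detectingPrefix g t m i *
        g ^ detectingExponent m i * detectingLetter t i := rfl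
    rw [h3, h4, ih, h1, h2]
    group

theorem detectingPrefix_four_mul (g t : Γ) (m : ℤ) (n : ℕ) :
    detectingPrefix g t m (4 * n) = detectingWord g t m ^ n := by
  induction n with
  | zero => simp [detectingPrefix, wordPrefix]
  | succ n ih => rw [mul_add, mul_one, detectingPrefix_add_four, ih, pow_succ']

theorem detectingPrefix_succ_of_four_dvd (g t : Γ) (m : ℤ) {i : ℕ} (hi : i % 4 = 0) :
    detectingPrefix g t m (i + 1) = detectingPrefix g t m i * (g ^ (8 * m) * t) := by
  have h : detectingPrefix g t m (i + 1) = detectingPrefix g t m i *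
        g ^ detectingExponent m i * detectingLetter t i := rfl
  have h2 : i % 2 = 0 := by omega
  rw [h]
  simp [detectingExponent, detectingLetter, hi, h2, mul_assoc]

theorem realHom_detectingWord (g t : Γ) (m : ℤ) {ψ : Γ → ℝ} (hψ : ψ ∈ realHom Γ) :
    ψ (detectingWord g t m) = 0 := by
  have hz : ∀ (x : Γ) (n : ℤ), ψ (x ^ n) = n * ψ x :=
    (realHom_le_homogeneousQuasiHom Γ hψ).2
  have h1 : ψ 1 = 0 := by simpa using hz 1 0
  have hi : ψ t⁻¹ = -ψ t := by simpa using hz t (-1)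
  have hmul : ∀ x y, ψ (x * y) = ψ x + ψ y := hψ
  simp only [detectingWord, detectingPrefix, wordPrefix, hmul, hz, h1, detectingExponent,
    detectingLetter]
  norm_num [hi]
  ring

theorem gatesComparable (A : AxisSystem g t x₀ E κ R) {m : ℤ} (hm : 100 * R ≤ m) :
    GatesComparable (translates Γ (gateSource κ R)) (translates Γ (gateTarget g t κ m)) := by
  intro h k x y hxh hxk hyh hyk
  have hR := A.one_le
  -- only the first condition defining `gateTarget` matters
  suffices (∀ p, 7 * m ≤ κ (k⁻¹ • p) → 4 * R < κ (h⁻¹ • p)) ∨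
      (∀ p, 7 * m ≤ κ (h⁻¹ • p) → 4 * R < κ (k⁻¹ • p)) from
    this.imp (fun H p hp hp' => absurd (H p hp.1) (not_lt.2 hp'))
      (fun H p hp hp' => absurd (H p hp.1) (not_lt.2 hp'))
  replace hyh : 7 * m ≤ κ (h⁻¹ • y) := hyh.1
  replace hyk : 7 * m ≤ κ (k⁻¹ • y) := hyk.1
  replace hxh : κ (h⁻¹ • x) ≤ 4 * R := hxh
  replace hxk : κ (k⁻¹ • x) ≤ 4 * R := hxk
  by_cases hE : h⁻¹ * k ∈ E
  · obtain ⟨ε, c, hε, hc⟩ := A.stabilizer _ hE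
    have hc' : ∀ p, |κ (k⁻¹ • p) - ε * κ (h⁻¹ • p) - c| ≤ R := fun p => by
      simpa [mul_smul] using hc (h⁻¹ • p)
    have hcx := hc' x
    have hcy := hc' y
    rcases hε with rfl | rfl
    · rcases le_total c 0 with h0 | h0
      · left
        intro p hp
        have := hc' p
        rw [abs_le] at this
        linarith
      · right
        intro p hp
        have := hc' p
        rw [abs_le] at this
        linarith
    · rw [abs_le] at hcx hcy
      linarith
  · have hx := A.behrstock' hE x
    have hy := A.behrstock' hE y
    have hp := A.behrstock' hE
    set u := κ (h⁻¹ • k • x₀)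
    set v := κ (k⁻¹ • h • x₀)
    have huv : (7 * m - R ≤ u ∧ v ≤ 5 * R) ∨ (7 * m - R ≤ v ∧ u ≤ 5 * R) := by
      simp only [abs_le] at hx hy
      omega
    rcases huv with ⟨h1, h2⟩ | ⟨h1, h2⟩
    · left
      intro p h3
      have := hp p
      simp only [abs_le] at this
      omega
    · right
      intro p h3
      have := hp p
      simp only [abs_le] at this
      omega

/-- Along a path with small steps, the number of gates of a chain that have been passed grows by at
most one in each step. -/
theorem gatesFinite (A : AxisSystem g t x₀ E κ R) {m : ℤ} (hm : 100 * R ≤ m) :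
    GatesFinite (translates Γ (gateSource κ R)) (translates Γ (gateTarget g t κ m)) := by
  intro x y
  have hR := A.one_le
  obtain ⟨l, p, hp0, hpl, hstep⟩ := A.path x y
  refine ⟨l, fun n k hk => ?_⟩
  by_contra hln
  have key : ∀ i ≤ l, ∀ j, i ≤ j → j < n → κ ((k j)⁻¹ • p i) < 7 * m := by
    intro i
    induction i with
    | zero =>
      intro _ j _ hj
      have : κ ((k j)⁻¹ • x) ≤ 4 * R := hk.left j hj rfl
      rw [hp0]
      linarith
    | succ i ih =>
      intro hi j hij hj
      have h1 := ih (by omega) (j - 1) (by omega) (by omega)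
      have h2 : κ ((k j)⁻¹ • p i) ≤ 4 * R := by
        refine (hk.precedes (j - 1) j (by omega) hj (p i)).resolve_right fun h => ?_
        exact absurd h.1 (not_le.2 h1)
      have h3 := hstep i (by omega) (k j)⁻¹
      rw [abs_le] at h3
      linarith
  have h1 := key l le_rfl l le_rfl (by omega)
  have h2 : 7 * m ≤ κ ((k l)⁻¹ • y) := (hk.right l (by omega) rfl).1
  rw [hpl] at h1
  linarith

theorem gateCount_eq_zero {S T : Set X} {x y : X}
    (h : ∀ k : Γ, k⁻¹ • x ∈ S → k⁻¹ • y ∉ T) :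
    gateCount (translates Γ S) (translates Γ T) {x} {y} = 0 := by
  refine Nat.le_zero.1 (csSup_le ⟨0, _, IsGateChain.zero _ _⟩ ?_)
  rintro n ⟨k, hk⟩
  by_contra hn
  have hn : 0 < n := not_le.1 hn
  exact h (k 0) (hk.left 0 hn rfl) (hk.right 0 hn rfl)

theorem le_gateCount_detectingWord (A : AxisSystem g t x₀ E κ R) {m : ℤ} (hm : 100 * R ≤ m)
    (n : ℕ) : n ≤ gateCount (translates Γ (gateSource κ R)) (translates Γ (gateTarget g t κ m))
      {x₀} {detectingWord g t m ^ n • x₀} := by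
  have hR := A.one_le
  have hs := detectingLetter_eq t
  have he := lt_abs_detectingExponent hR hm
  refine IsGateChain.le_gateCount (A.gatesFinite hm) (by simp) (by simp)
    (k := fun i => detectingWord g t m ^ i) ⟨fun i hi => ?_, fun i hi => ?_, fun i j hij hj p => ?_⟩
  · rw [singleton_subset_iff]
    have h := A.coord_of_le hs he (Nat.zero_le (4 * i))
    change κ ((detectingWord g t m ^ i)⁻¹ • x₀) ≤ 4 * R
    change |κ ((detectingPrefix g t m (4 * i))⁻¹ • (1 : Γ) • x₀)| ≤ 3 * R at h
    rw [detectingPrefix_four_mul, one_smul, abs_le] at h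
    linarith
  · rw [singleton_subset_iff]
    have h1 := A.coord_of_lt hs he (show 4 * i < 4 * n by omega)
    have h2 := A.coord_of_lt hs he (show 4 * i + 1 < 4 * n by omega)
    change |κ ((detectingPrefix g t m (4 * i))⁻¹ • detectingPrefix g t m (4 * n) • x₀) - _| ≤ _
      at h1
    change |κ ((detectingPrefix g t m (4 * i + 1))⁻¹ • detectingPrefix g t m (4 * n) • x₀) - _| ≤ _
      at h2
    rw [detectingPrefix_succ_of_four_dvd _ _ _ (by omega)] at h2
    rw [detectingPrefix_four_mul, detectingPrefix_four_mul] at h1 h2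
    have e1 := detectingExponent_cases m (4 * i)
    have e2 := detectingExponent_cases m (4 * i + 1)
    rw [abs_le] at h1 h2
    change 7 * m ≤ _ ∧ κ ((g ^ (8 * m) * t)⁻¹ • _) ≤ -3 * m
    refine ⟨by omega, ?_⟩
    rw [smul_smul, ← mul_inv_rev]
    omega
  · by_cases hp : p ∈ translates Γ (gateSource κ R) (detectingWord g t m ^ j)
    · exact Or.inl hp
    right
    replace hp : 4 * R < κ ((detectingWord g t m ^ j)⁻¹ • p) := not_le.1 hp
    rw [← detectingPrefix_four_mul] at hp
    have hp' : 3 * R < |κ ((detectingPrefix g t m (4 * j))⁻¹ • p)| :=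
      lt_of_lt_of_le (by linarith) (le_abs_self _)
    have h1 := A.coord_of_entered hs he hp' (show 4 * i < 4 * j by omega)
    have h2 := A.coord_of_entered hs he hp' (show 4 * i + 1 < 4 * j by omega)
    change |κ ((detectingPrefix g t m (4 * i))⁻¹ • p) - _| ≤ _ at h1
    change |κ ((detectingPrefix g t m (4 * i + 1))⁻¹ • p) - _| ≤ _ at h2
    rw [detectingPrefix_succ_of_four_dvd _ _ _ (by omega)] at h2
    rw [detectingPrefix_four_mul] at h1 h2
    have e1 := detectingExponent_cases m (4 * i)
    have e2 := detectingExponent_cases m (4 * i + 1)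
    rw [abs_le] at h1 h2
    refine ⟨by omega, ?_⟩
    rw [smul_smul, ← mul_inv_rev]
    omega

/-- The gates do not occur in the reversed direction along the path of the detecting word: there
the long parts of axes are followed by short ones. -/
theorem gateCount_detectingWord_reverse (A : AxisSystem g t x₀ E κ R) {m : ℤ} (hm : 100 * R ≤ m)
    (n : ℕ) : gateCount (translates Γ (gateSource κ R)) (translates Γ (gateTarget g t κ m))
      {detectingWord g t m ^ n • x₀} {x₀} = 0 := by
  have hR := A.one_le
  have hs := detectingLetter_eq t
  have he := lt_abs_detectingExponent hR hm
  refine gateCount_eq_zero fun h hyh hxh => ?_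
  rw [← detectingPrefix_four_mul] at hyh
  obtain ⟨hx1, hx2⟩ := hxh
  replace hyh : κ (h⁻¹ • detectingPrefix g t m (4 * n) • x₀) ≤ 4 * R := hyh
  rw [smul_smul, ← mul_inv_rev] at hx2
  set k := h * (g ^ (8 * m) * t) with hk
  have hkh : h⁻¹ * k = g ^ (8 * m) * t := by simp [hk]
  have hhk : h⁻¹ * k ∉ E := by
    rw [hkh, E.mul_mem_cancel_left (E.zpow_mem A.mem _)]
    exact A.notMem
  -- the positions of the two axes with respect to each other
  have hcoord1 : |κ (h⁻¹ • k • x₀) - 8 * m| ≤ R := by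
    have h1 := A.jump 1
    rw [smul_smul, hkh, mul_smul, coord_zpow_smul A.smul]
    simpa [A.base] using h1
  have hcoord2 : |κ (k⁻¹ • h • x₀)| ≤ 2 * R := by
    have h1 : k⁻¹ • h • x₀ = (t⁻¹ * g ^ (-(8 * m))) • x₀ := by
      simp [hk, mul_smul]
    have h2 := A.bounded t⁻¹ (by simpa using A.notMem) _ (E.zpow_mem A.mem (-(8 * m)))
    have h3 := A.jump t⁻¹
    rw [inv_smul_smul, A.base] at h3
    rw [h1]
    rw [abs_le] at *
    constructor <;> linarith
  have hyk : |κ (k⁻¹ • detectingPrefix g t m (4 * n) • x₀)| ≤ 3 * R := by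
    have h1 := A.behrstock' hhk (detectingPrefix g t m (4 * n) • x₀)
    simp only [abs_le] at *
    omega
  -- both axes are among those followed by the word
  obtain ⟨i, hin, hiE, hi⟩ := (A.displacement_le hs he h (4 * n)).resolve_left (by
    change ¬ |_ - κ (h⁻¹ • detectingPrefix g t m (4 * n) • x₀)| ≤ _
    rw [abs_le]; omega)
  obtain ⟨j, hjn, hjE, hj⟩ := (A.displacement_le hs he k (4 * n)).resolve_left (by
    change ¬ |_ - κ (k⁻¹ • detectingPrefix g t m (4 * n) • x₀)| ≤ _
    rw [abs_le] at hyk ⊢; omega)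
  change (detectingPrefix g t m i)⁻¹ * h ∈ E at hiE
  change (detectingPrefix g t m j)⁻¹ * k ∈ E at hjE
  change |_ - κ (h⁻¹ • detectingPrefix g t m (4 * n) • x₀)| ≤ _ at hi
  change |_ - κ (k⁻¹ • detectingPrefix g t m (4 * n) • x₀)| ≤ _ at hj
  have hi4 : i % 4 = 0 := by
    rcases detectingExponent_cases m i with h | h | h | h <;> rw [h.2] at hi
    · exact h.1
    all_goals
      exfalso
      simp only [abs_le, abs_mul, abs_of_nonneg (show 0 ≤ m by linarith)] at hi
      norm_num at hi
      linarith
  have hj4 : j % 4 ≠ 3 := by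
    intro hj3
    rcases detectingExponent_cases m j with h | h | h | h
    · omega
    · omega
    · omega
    rw [h.2] at hj
    simp only [abs_le, abs_mul, abs_of_nonneg (show 0 ≤ m by linarith)] at hj hyk
    norm_num at hj
    linarith
  have hkbound : ∀ l : Γ, l⁻¹ * h ∉ E → |κ (l⁻¹ • k • x₀) - κ (l⁻¹ • h • x₀)| ≤ 2 * R := by
    intro l hl
    have h1 := A.bounded _ hl _ (E.zpow_mem A.mem (8 * m))
    have h2 := A.jump (l⁻¹ * h * g ^ (8 * m))
    simp only [mul_smul] at h1 h2
    simp only [hk, mul_smul]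
    rw [abs_le] at *
    constructor <;> linarith
  -- the axis of index `a` as seen from any other axis `l`
  have hsame : ∀ (l b : Γ) (a : ℕ), (detectingPrefix g t m a)⁻¹ * b ∈ E →
      l⁻¹ * detectingPrefix g t m a ∉ E →
      |κ (l⁻¹ • b • x₀) - κ (l⁻¹ • detectingPrefix g t m a • x₀)| ≤ R := by
    intro l b a hE hl
    have := A.bounded _ hl _ hE
    simpa [mul_smul] using this
  rcases lt_trichotomy i j with hij | rfl | hij
  · -- the far end of the word and the second axis lie on the same side of the first axis
    obtain ⟨ε, c, hε, hc⟩ := A.stabilizer _ hiE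
    have h1 := hc ((detectingPrefix g t m i)⁻¹ • k • x₀)
    have h2 := hc ((detectingPrefix g t m i)⁻¹ • detectingPrefix g t m (4 * n) • x₀)
    simp only [mul_inv_rev, inv_inv, mul_smul, smul_inv_smul] at h1 h2
    have hne : (detectingPrefix g t m i)⁻¹ * detectingPrefix g t m j ∉ E := by
      intro hmem
      have h3 := E.mul_mem (E.mul_mem (E.inv_mem hiE) hmem) hjE
      apply hhk
      simpa [mul_assoc] using h3
    have h3 := hsame _ _ _ hjE hne
    have h4 := A.coord_of_lt hs he hij
    have h5 := A.coord_of_lt hs he hin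
    change |κ ((detectingPrefix g t m i)⁻¹ • detectingPrefix g t m j • x₀) - _| ≤ _ at h4
    change |κ ((detectingPrefix g t m i)⁻¹ • detectingPrefix g t m (4 * n) • x₀) - _| ≤ _ at h5
    rw [abs_le] at *
    rcases hε with rfl | rfl <;> linarith
  · apply hhk
    have := E.mul_mem (E.inv_mem hiE) hjE
    simpa [mul_assoc] using this
  · -- the axis of index `i - 1` separates the two axes, which are too close for that
    obtain ⟨a, rfl⟩ : ∃ a, i = a + 1 := ⟨i - 1, by omega⟩
    have hja : j < a := by omega
    have ha1 : (detectingPrefix g t m a)⁻¹ * detectingPrefix g t m (a + 1) ∉ E :=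
      A.step_notMem hs a
    have haj : (detectingPrefix g t m a)⁻¹ * detectingPrefix g t m j ∉ E := by
      intro hmem
      obtain ⟨ε, c, hε, hc⟩ := A.stabilizer _ hmem
      -- the axes of index `a` and `j` differ, by the positions of three points
      have c1 := hc ((detectingPrefix g t m a)⁻¹ • detectingPrefix g t m j • x₀)
      have c2 := hc ((detectingPrefix g t m a)⁻¹ • detectingPrefix g t m a • x₀)
      have c3 := hc ((detectingPrefix g t m a)⁻¹ • detectingPrefix g t m (a + 1) • x₀)
      simp only [mul_inv_rev, inv_inv, mul_smul, smul_inv_smul, inv_smul_smul] at c1 c2 c3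
      have d1 := A.coord_of_le hs he hja.le
      have d2 := A.coord_of_lt hs he hja
      have d3 := A.coord_of_lt hs he (show j < a + 1 by omega)
      have d4 := A.coord_of_lt hs he (show a < a + 1 by omega)
      change |κ ((detectingPrefix g t m a)⁻¹ • detectingPrefix g t m j • x₀)| ≤ _ at d1
      change |κ ((detectingPrefix g t m j)⁻¹ • detectingPrefix g t m a • x₀) - _| ≤ _ at d2
      change |κ ((detectingPrefix g t m j)⁻¹ • detectingPrefix g t m (a + 1) • x₀) - _| ≤ _ at d3
      change |κ ((detectingPrefix g t m a)⁻¹ • detectingPrefix g t m (a + 1) • x₀) - _| ≤ _ at d4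
      have d5 := he a
      rw [A.base] at c1 c2
      rw [lt_abs] at d5
      simp only [abs_le] at *
      rcases hε with rfl | rfl <;> omega
    have hah : (detectingPrefix g t m a)⁻¹ * h ∉ E := by
      intro hmem
      apply ha1
      have := E.mul_mem hmem (E.inv_mem hiE)
      simpa [mul_assoc] using this
    have h1 := hkbound _ hah
    have h2 := hsame _ _ _ hiE ha1
    have h3 := hsame _ _ _ hjE haj
    have h4 := A.coord_of_lt hs he (show a < a + 1 by omega)
    have h5 := A.coord_of_le hs he hja.le
    change |κ ((detectingPrefix g t m a)⁻¹ • detectingPrefix g t m (a + 1) • x₀) - _| ≤ _ at h4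
    change |κ ((detectingPrefix g t m a)⁻¹ • detectingPrefix g t m j • x₀)| ≤ _ at h5
    have h6 := he a
    rw [lt_abs] at h6
    simp only [abs_le] at *
    omega

/-- Gates for a large parameter are not seen by detecting words of smaller parameter. -/
theorem gateFlow_detectingWord_eq_zero (A : AxisSystem g t x₀ E κ R) {m m' : ℤ}
    (hm' : 100 * R ≤ m') (hmm : 4 * m' ≤ m) (n : ℕ) :
    gateFlow (translates Γ (gateSource κ R)) (translates Γ (gateTarget g t κ m))
      x₀ (detectingWord g t m' ^ n • x₀) = 0 := by
  have hR := A.one_le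
  have hs := detectingLetter_eq t
  have he := lt_abs_detectingExponent hR hm'
  have key : ∀ h : Γ, |κ (h⁻¹ • x₀) - κ (h⁻¹ • detectingWord g t m' ^ n • x₀)| ≤
      8 * m' + 7 * R := by
    intro h
    rw [← detectingPrefix_four_mul]
    rcases A.displacement_le hs he h (4 * n) with h1 | ⟨i, -, -, h1⟩
    · exact h1.trans (by linarith)
    · refine h1.trans ?_
      have : |detectingExponent m' i| ≤ 8 * m' := by
        rw [abs_le]
        rcases detectingExponent_cases m' i with h | h | h | h <;> rw [h.2] <;> omega
      linarith
  rw [gateFlow, gateCount_eq_zero, gateCount_eq_zero]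
  · simp
  · intro h h1 h2
    have h3 := key h
    have h4 := h2.1
    replace h1 : κ _ ≤ 4 * R := h1
    rw [abs_le] at h3
    linarith
  · intro h h1 h2
    have h3 := key h
    have h4 := h2.1
    replace h1 : κ _ ≤ 4 * R := h1
    rw [abs_le] at h3
    linarith

theorem not_finiteDimensional (A : AxisSystem g t x₀ E κ R) :
    ¬ FiniteDimensional ℝ (QHTilde Γ) := by
  have hR := A.one_le
  set m : ℕ → ℤ := fun i => 100 * R * 4 ^ i with hm
  have hm0 : ∀ i, 100 * R ≤ m i := fun i => by
    have : (1 : ℤ) ≤ 4 ^ i := one_le_pow₀ (by norm_num)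
    simp only [hm]
    nlinarith
  have hm1 : ∀ i j, j < i → 4 * m j ≤ m i := fun i j hij => by
    have : (4 : ℤ) ^ (j + 1) ≤ 4 ^ i := pow_le_pow_right₀ (by norm_num) hij
    simp only [hm]
    rw [pow_succ] at this
    nlinarith
  choose φ hφ C hC using fun i =>
    (isQuasiHom_gateFlow (A.gatesFinite (hm0 i)) (A.gatesComparable (hm0 i)) x₀).exists_homogeneous
  refine not_finiteDimensional_QHTilde (φ := φ) (f := fun i => detectingWord g t (m i)) hφ
    (fun i h0 => ?_) (fun i j hij => ?_) (fun j ψ hψ => realHom_detectingWord g t _ hψ)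
  · obtain ⟨n, hn⟩ := exists_nat_gt (C i)
    have h1 := hC i (detectingWord g t (m i) ^ n)
    have h2 := (hφ i).2 (detectingWord g t (m i)) n
    rw [zpow_natCast] at h2
    have h3 := A.le_gateCount_detectingWord (hm0 i) n
    rw [h2, h0, gateFlow, A.gateCount_detectingWord_reverse (hm0 i), abs_le] at h1
    have h4 : (n : ℝ) ≤ _ := Nat.cast_le.2 h3
    push_cast at h1
    linarith [h1.1]
  · refine eq_zero_of_bounded_on_powers (hφ i) (C := C i) fun n => ?_
    have h1 := hC i (detectingWord g t (m j) ^ n)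
    rw [A.gateFlow_detectingWord_eq_zero (hm0 j) (hm1 i j hij)] at h1
    simpa using h1

end AxisSystem

end AxisSystems

/-! ### Contracting geodesic segments -/

section Contracting

variable {X : Type*} [MetricSpace X]

theorem IsGeodesicSegment.isCompact {S : Set X} {a b : X} (h : IsGeodesicSegment S a b) :
    IsCompact S := by
  obtain ⟨γ, -, -, hγ, rfl⟩ := h
  refine isCompact_Icc.image_of_continuousOn (LipschitzOnWith.continuousOn (K := 1) ?_)
  refine LipschitzOnWith.of_dist_le_mul fun s hs t ht => ?_
  simp [hγ s hs t ht, Real.dist_eq]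

theorem IsGeodesicSegment.nonempty {S : Set X} {a b : X} (h : IsGeodesicSegment S a b) :
    S.Nonempty := by
  obtain ⟨γ, -, -, -, rfl⟩ := h
  exact ⟨_, mem_image_of_mem _ (left_mem_Icc.2 dist_nonneg)⟩

theorem IsGeodesicSegment.dist_add_dist {S : Set X} {a b s : X} (h : IsGeodesicSegment S a b)
    (hs : s ∈ S) : dist a s + dist s b = dist a b := by
  obtain ⟨γ, h0, h1, hγ, rfl⟩ := h
  obtain ⟨r, hr, rfl⟩ := hs
  have h2 := hγ 0 (left_mem_Icc.2 dist_nonneg) r hr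
  have h3 := hγ r hr _ (right_mem_Icc.2 dist_nonneg)
  rw [h0, zero_sub, abs_neg, abs_of_nonneg hr.1] at h2
  rw [h1, abs_sub_comm, abs_of_nonneg (by linarith [hr.2])] at h3
  linarith

theorem IsCAT0.subset_of_isGeodesicSegment (hX : IsCAT0 X) {S T : Set X} {a b : X}
    (hS : IsGeodesicSegment S a b) (hT : IsGeodesicSegment T a b) : S ⊆ T := by
  intro x hx
  obtain ⟨η, η0, η1, hη, hηT⟩ := id hT
  obtain ⟨γ, γ0, γ1, hγ, hγS⟩ := id hS
  rw [hγS] at hx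
  obtain ⟨s, hs, rfl⟩ := hx
  have hx : dist a (γ s) = s := by
    have := hγ 0 (left_mem_Icc.2 dist_nonneg) s hs
    rwa [γ0, zero_sub, abs_neg, abs_of_nonneg hs.1] at this
  have hy : dist a (η s) = s := by
    have := hη 0 (left_mem_Icc.2 dist_nonneg) s hs
    rwa [η0, zero_sub, abs_neg, abs_of_nonneg hs.1] at this
  -- a degenerate comparison triangle, two of whose vertices are `q'`
  set q' : EuclideanSpace ℝ (Fin 2) := EuclideanSpace.single 0 (dist a b) with hq'
  set x' : EuclideanSpace ℝ (Fin 2) := (s / dist a b) • q' with hx'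
  have hnq : ‖q'‖ = dist a b := by
    rw [hq', PiLp.norm_single, Real.norm_of_nonneg dist_nonneg]
  have hnx : ‖x'‖ = s := by
    rw [hx', norm_smul, hnq, Real.norm_of_nonneg (div_nonneg hs.1 dist_nonneg)]
    rcases eq_or_ne (dist a b) 0 with h | h
    · have := hs.2
      rw [h] at this ⊢
      linarith [hs.1]
    · field_simp
  have hseg : x' ∈ segment ℝ (0 : EuclideanSpace ℝ (Fin 2)) q' := by
    rw [segment_eq_image]
    refine ⟨s / dist a b, ⟨div_nonneg hs.1 dist_nonneg,
      div_le_one_of_le₀ hs.2 dist_nonneg⟩, by simp [hx']⟩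
  have h := hX.comparison a b b S T hS hT 0 q' q' (by simpa using hnq) (by simp)
    (by simpa using hnq) (γ s) (hγS ▸ mem_image_of_mem _ hs) (η s) (hηT ▸ mem_image_of_mem _ hs)
    x' hseg x' hseg (by simpa [hx] using hnx) (by simpa [hy] using hnx)
  rw [dist_self] at h
  rw [dist_le_zero.1 h, hηT]
  exact mem_image_of_mem _ hs

theorem IsCAT0.isGeodesicSegment_unique (hX : IsCAT0 X) {S T : Set X} {a b : X}
    (hS : IsGeodesicSegment S a b) (hT : IsGeodesicSegment T a b) : S = T :=
  (hX.subset_of_isGeodesicSegment hS hT).antisymm (hX.subset_of_isGeodesicSegment hT hS)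

theorem IsCompact.nearestPoints_nonempty {S : Set X} (hS : IsCompact S) (hne : S.Nonempty) (p : X) :
    (nearestPoints S p).Nonempty := by
  obtain ⟨s, hs, h⟩ := hS.exists_isMinOn hne (f := fun q => dist p q) (by fun_prop)
  exact ⟨s, hs, fun q hq => h hq⟩

variable {S : Set X} {B : ℝ}

theorem IsContracting.dist_lt (hS : IsContracting B S) (hb : Bornology.IsBounded S) {p q p' q' : X}
    (hp : p' ∈ nearestPoints S p) (hq : q' ∈ nearestPoints S q) (h : dist p q < dist p p') :
    dist p' q' < B := by
  have hdisj : Disjoint (Metric.ball p (dist p p')) S := by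
    rw [Set.disjoint_left]
    intro s hs hsS
    rw [Metric.mem_ball, dist_comm] at hs
    exact absurd (hp.2 s hsS) (not_le.2 hs)
  refine (Metric.dist_le_diam_of_mem (hb.subset ?_) ?_ ?_).trans_lt (hS p _ hdisj)
  · exact iUnion₂_subset fun x _ s hs => hs.1
  · exact mem_biUnion (Metric.mem_ball_self (dist_nonneg.trans_lt h)) hp
  · exact mem_biUnion (by rwa [Metric.mem_ball, dist_comm]) hq

theorem IsContracting.dist_lt_self (hS : IsContracting B S) (hb : Bornology.IsBounded S)
    (hB : 0 < B) {p p' q' : X} (hp : p' ∈ nearestPoints S p) (hq : q' ∈ nearestPoints S p) :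
    dist p' q' < B := by
  rcases eq_or_lt_of_le (dist_nonneg (x := p) (y := p')) with h | h
  · have h1 := hq.2 p' hp.1
    rw [← h] at h1
    rw [← dist_le_zero.1 h.ge, ← dist_le_zero.1 h1]
    simpa using hB
  · exact hS.dist_lt hb hp hq (by simpa using h)

/-- Along a path that stays away from `S`, the projection to `S` moves at most at half the speed. -/
theorem IsContracting.dist_le_of_far (hS : IsContracting B S) (hc : IsCompact S)
    (hne : S.Nonempty) (hB : 0 < B) {γ : ℝ → X} {a b : ℝ} (hab : a ≤ b)
    (hγ : ∀ s ∈ Icc a b, ∀ t ∈ Icc a b, dist (γ s) (γ t) ≤ |s - t|)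
    (hfar : ∀ s ∈ Ico a b, 2 * B < Metric.infDist (γ s) S) {a' b' : X}
    (ha : a' ∈ nearestPoints S (γ a)) (hb : b' ∈ nearestPoints S (γ b)) :
    dist a' b' ≤ (b - a) + 2 * B := by
  have hfar' : ∀ s ∈ Ico a b, ∀ w ∈ nearestPoints S (γ s), 2 * B < dist (γ s) w :=
    fun s hs w hw => (hfar s hs).trans_le (Metric.infDist_le_dist_of_mem hw.1)
  have key : ∀ (n : ℕ) (c : ℝ), a ≤ c → c ≤ b → b - c ≤ n * (2 * B) →
      ∀ c' ∈ nearestPoints S (γ c), dist c' b' ≤ (n + 1) * B := by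
    intro n
    induction n with
    | zero =>
      intro c hac hcb h c' hc'
      have : c = b := le_antisymm hcb (by simpa using h)
      subst this
      simpa using (hS.dist_lt_self hc.isBounded hB hc' hb).le
    | succ n ih =>
      intro c hac hcb h c' hc'
      push_cast at h ⊢
      by_cases hlast : c + 2 * B ≤ b
      · obtain ⟨d', hd'⟩ := hc.nearestPoints_nonempty hne (γ (c + 2 * B))
        have h1 := ih (c + 2 * B) (by linarith) hlast (by linarith) d' hd'
        have h2 := hS.dist_lt hc.isBounded hc' hd' (by
          refine lt_of_le_of_lt (hγ c ⟨hac, hcb⟩ _ ⟨by linarith, hlast⟩) ?_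
          rw [show c - (c + 2 * B) = -(2 * B) by ring, abs_neg, abs_of_pos (by linarith)]
          exact hfar' c ⟨hac, by linarith⟩ c' hc')
        linarith [dist_triangle c' d' b']
      · rcases hcb.eq_or_lt with rfl | hlt
        · have := hS.dist_lt_self hc.isBounded hB hc' hb
          have : 0 ≤ (n + 1) * B := by positivity
          linarith
        · have h2 := hS.dist_lt hc.isBounded hc' hb (by
            refine lt_of_le_of_lt (hγ c ⟨hac, hcb⟩ b ⟨hab, le_rfl⟩) ?_
            rw [abs_sub_comm, abs_of_pos (by linarith)]
            exact lt_trans (by linarith) (hfar' c ⟨hac, hlt⟩ c' hc'))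
          have : 0 ≤ (n + 1) * B := by positivity
          linarith
  have h1 := key ⌈(b - a) / (2 * B)⌉₊ a le_rfl hab (by
    rw [← div_le_iff₀ (by linarith)]
    exact Nat.le_ceil _) a' ha
  have h2 := (Nat.ceil_lt_add_one (div_nonneg (sub_nonneg.2 hab) (by linarith : 0 ≤ 2 * B))).le
  have h3 : ((b - a) / (2 * B) + 1 + 1) * B = (b - a) / 2 + 2 * B := by
    field_simp
    ring
  have h4 : ((⌈(b - a) / (2 * B)⌉₊ : ℝ) + 1) * B ≤ ((b - a) / (2 * B) + 1 + 1) * B := by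
    gcongr
  linarith

/-- The projection to a contracting set is coarsely `1`-Lipschitz. -/
theorem IsContracting.dist_le_add (hX : IsCAT0 X) (hS : IsContracting B S) (hc : IsCompact S)
    (hne : S.Nonempty) (hB : 0 < B) {u v u' v' : X}
    (hu : u' ∈ nearestPoints S u) (hv : v' ∈ nearestPoints S v) :
    dist u' v' ≤ dist u v + 8 * B := by
  obtain ⟨-, γ, γ0, γ1, hγ, -⟩ := hX.exists_geodesic u v
  set l := dist u v with hl
  have hl0 : 0 ≤ l := dist_nonneg
  have hcont : ContinuousOn (fun t => Metric.infDist (γ t) S) (Icc 0 l) := by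
    refine (Metric.continuous_infDist_pt S).comp_continuousOn
      (LipschitzOnWith.continuousOn (K := 1) ?_)
    refine LipschitzOnWith.of_dist_le_mul fun s hs t ht => ?_
    simp [hγ s hs t ht, Real.dist_eq]
  set Z : Set ℝ := Icc 0 l ∩ (fun t => Metric.infDist (γ t) S) ⁻¹' Iic (2 * B) with hZ
  have hZc : IsCompact Z :=
    isCompact_Icc.of_isClosed_subset (hcont.preimage_isClosed_of_isClosed isClosed_Icc isClosed_Iic)
      inter_subset_left
  rcases Z.eq_empty_or_nonempty with h | h
  · have h1 := hS.dist_le_of_far hc hne hB hl0 (fun s hs t ht => (hγ s hs t ht).le)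
      (fun s hs => by
        by_contra hle
        have : s ∈ Z := ⟨Ico_subset_Icc_self hs, not_lt.1 hle⟩
        rw [h] at this
        exact this) (by rwa [γ0]) (by rwa [γ1])
    linarith
  · obtain ⟨t₁, ht₁, hmin⟩ := hZc.exists_isLeast h
    obtain ⟨t₂, ht₂, hmax⟩ := hZc.exists_isGreatest h
    have h12 : t₁ ≤ t₂ := hmin ht₂
    obtain ⟨w₁, hw₁⟩ := hc.nearestPoints_nonempty hne (γ t₁)
    obtain ⟨w₂, hw₂⟩ := hc.nearestPoints_nonempty hne (γ t₂)
    have hd : ∀ t ∈ Z, ∀ w ∈ nearestPoints S (γ t), dist (γ t) w ≤ 2 * B := fun t ht w hw =>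
      ((Metric.le_infDist hne).2 fun {y} hy => hw.2 y hy).trans ht.2
    have h1 : dist u' w₁ ≤ (t₁ - 0) + 2 * B := by
      refine hS.dist_le_of_far hc hne hB ht₁.1.1
        (fun s hs t ht => (hγ s ⟨hs.1, hs.2.trans ht₁.1.2⟩ t ⟨ht.1, ht.2.trans ht₁.1.2⟩).le)
        (fun s hs => ?_) (by rwa [γ0]) hw₁
      by_contra hle
      exact absurd (hmin ⟨⟨hs.1, hs.2.le.trans ht₁.1.2⟩, not_lt.1 hle⟩) (not_le.2 hs.2)
    have h2 : dist v' w₂ ≤ (-t₂ - -l) + 2 * B := by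
      refine hS.dist_le_of_far (γ := fun t => γ (-t)) hc hne hB (neg_le_neg ht₂.1.2)
        (fun s hs t ht => ?_) (fun s hs => ?_) (by simpa [γ1] using hv) (by simpa using hw₂)
      · have h3 := ht₂.1.1
        refine (hγ (-s) ⟨by linarith [hs.2], by linarith [hs.1]⟩ (-t)
          ⟨by linarith [ht.2], by linarith [ht.1]⟩).le.trans_eq ?_
        rw [abs_sub_comm]
        ring_nf
      · by_contra hle
        have h3 := ht₂.1.1
        have := hmax ⟨⟨by linarith [hs.2], by linarith [hs.1]⟩, not_lt.1 hle⟩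
        linarith [hs.2]
    have h3 := hγ t₁ ht₁.1 t₂ ht₂.1
    rw [abs_sub_comm, abs_of_nonneg (sub_nonneg.2 h12)] at h3
    have h4 := hd t₁ ht₁ w₁ hw₁
    have h5 := hd t₂ ht₂ w₂ hw₂
    have h6 := dist_triangle4 w₁ (γ t₁) (γ t₂) w₂
    have h7 := dist_triangle4 u' w₁ w₂ v'
    rw [dist_comm] at h4
    rw [dist_comm w₂] at h7
    linarith

/-- A geodesic between points whose projections to `S` are far apart passes close to both
projections. -/
theorem IsContracting.dist_add_dist_le (hX : IsCAT0 X) (hS : IsContracting B S) (hc : IsCompact S)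
    (hne : S.Nonempty) (hB : 0 < B) {p q p' q' : X}
    (hp : p' ∈ nearestPoints S p) (hq : q' ∈ nearestPoints S q) (hpq : 2 * B ≤ dist p' q') :
    dist p p' + dist p' q' + dist q' q ≤ dist p q + 12 * B := by
  obtain ⟨-, γ, γ0, γ1, hγ, -⟩ := hX.exists_geodesic p q
  have hbdd := hc.isBounded
  set l := dist p q with hl
  have hl0 : 0 ≤ l := dist_nonneg
  have hpγ : ∀ r ∈ Icc 0 l, dist p (γ r) = r := fun r hr => by
    have := hγ 0 (left_mem_Icc.2 hl0) r hr
    rwa [γ0, zero_sub, abs_neg, abs_of_nonneg hr.1] at this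
  have hqγ : ∀ r ∈ Icc 0 l, dist q (γ r) = l - r := fun r hr => by
    have := hγ _ (right_mem_Icc.2 hl0) r hr
    rwa [γ1, abs_of_nonneg (by linarith [hr.2])] at this
  rw [dist_comm q' q]
  have ha0 : 0 ≤ dist p p' := dist_nonneg
  have hb0 : 0 ≤ dist q q' := dist_nonneg
  by_cases hlt : l < dist p p' + dist q q'
  · exfalso
    refine absurd hpq (not_le.2 ?_)
    rcases ha0.eq_or_lt with h | ha
    · have := hS.dist_lt hbdd hq hp (by rw [dist_comm q p]; linarith)
      rw [dist_comm]
      linarith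
    rcases hb0.eq_or_lt with h | hb
    · have := hS.dist_lt hbdd hp hq (by linarith)
      linarith
    have hab : 0 < dist p p' + dist q q' := by linarith
    obtain ⟨r, hr0, hrl, hra, hrb⟩ : ∃ r, 0 ≤ r ∧ r ≤ l ∧ r < dist p p' ∧ l - r < dist q q' := by
      refine ⟨l * dist p p' / (dist p p' + dist q q'), by positivity, ?_, ?_, ?_⟩
      · rw [div_le_iff₀ hab]
        nlinarith
      · rw [div_lt_iff₀ hab]
        nlinarith
      · rw [sub_lt_comm, lt_div_iff₀ hab]
        nlinarith
    obtain ⟨w, hw⟩ := hc.nearestPoints_nonempty hne (γ r)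
    have h1 := hS.dist_lt hbdd hp hw (by rwa [hpγ r ⟨hr0, hrl⟩])
    have h2 := hS.dist_lt hbdd hq hw (by rwa [hqγ r ⟨hr0, hrl⟩])
    rw [dist_comm] at h2
    linarith [dist_triangle p' w q']
  · -- move by almost the distance to `S` from each end
    set a := max (dist p p' - B) 0 with ha
    set b := max (dist q q' - B) 0 with hb
    have ha1 : dist p p' - B ≤ a := le_max_left _ _
    have hb1 : dist q q' - B ≤ b := le_max_left _ _
    have ha2 : 0 ≤ a := le_max_right _ _
    have hb2 : 0 ≤ b := le_max_right _ _
    have ha3 : a ≤ dist p p' := max_le (by linarith) ha0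
    have hb3 : b ≤ dist q q' := max_le (by linarith) hb0
    have hmem1 : a ∈ Icc 0 l := ⟨ha2, by linarith⟩
    have hmem2 : l - b ∈ Icc 0 l := ⟨by linarith, by linarith⟩
    obtain ⟨u, hu⟩ := hc.nearestPoints_nonempty hne (γ a)
    obtain ⟨v, hv⟩ := hc.nearestPoints_nonempty hne (γ (l - b))
    have h1 : dist p' u < B := by
      rcases ha0.eq_or_lt with h | h
      · have : a = 0 := le_antisymm (by linarith) ha2
        rw [this, γ0] at hu
        exact hS.dist_lt_self hbdd hB hp hu
      · refine hS.dist_lt hbdd hp hu ?_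
        rw [hpγ a hmem1]
        exact max_lt (by linarith) h
    have h2 : dist q' v < B := by
      rcases hb0.eq_or_lt with h | h
      · have : b = 0 := le_antisymm (by linarith) hb2
        rw [this, sub_zero, γ1] at hv
        exact hS.dist_lt_self hbdd hB hq hv
      · refine hS.dist_lt hbdd hq hv ?_
        rw [hqγ _ hmem2, sub_sub_cancel]
        exact max_lt (by linarith) h
    have h3 := hS.dist_le_add hX hc hne hB hu hv
    rw [hγ a hmem1 _ hmem2, abs_sub_comm, abs_of_nonneg (by linarith)] at h3
    have h4 := dist_triangle4 p' u v q'
    rw [dist_comm v q'] at h4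
    linarith

end Contracting

/-! ### The orbit of the base point under a rank 1 isometry -/

section OrbitAxes

variable {Γ X : Type*} [Group Γ] [MetricSpace X] [MulAction Γ X]

/-- The orbit of `x₀` under the powers of `g` is a contracting quasi-geodesic, with errors at most
`C`. The integer `κ p` is the exponent of an orbit point nearest to `p`. -/
structure OrbitAxis (g : Γ) (x₀ : X) (κ : X → ℤ) (C : ℝ) : Prop where
  pos : 0 < C
  smul : ∀ p, κ (g • p) = κ p + 1
  base : κ x₀ = 0
  dist_le : ∀ p (j : ℤ), dist p (g ^ κ p • x₀) ≤ dist p (g ^ j • x₀)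
  proper : ∀ D, ∃ K : ℤ, ∀ j : ℤ, dist x₀ (g ^ j • x₀) ≤ D → |j| ≤ K
  additive : ∀ i k j : ℤ, (i ≤ k ∧ k ≤ j) ∨ (j ≤ k ∧ k ≤ i) →
    dist (g ^ i • x₀) (g ^ k • x₀) + dist (g ^ k • x₀) (g ^ j • x₀) ≤
      dist (g ^ i • x₀) (g ^ j • x₀) + C
  contract : ∀ p q, C ≤ dist (g ^ κ p • x₀) (g ^ κ q • x₀) →
    dist p (g ^ κ p • x₀) + dist (g ^ κ p • x₀) (g ^ κ q • x₀) + dist (g ^ κ q • x₀) q ≤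
      dist p q + C

variable [IsIsometricSMul Γ X]

theorem dist_zpow_smul (g : Γ) (x₀ : X) (i j : ℤ) :
    dist (g ^ i • x₀) (g ^ j • x₀) = dist x₀ (g ^ (j - i) • x₀) := by
  rw [← dist_smul (g ^ (-i))]
  simp only [smul_smul, ← zpow_add]
  simp [sub_eq_neg_add]

theorem dist_zpow_smul_abs (g : Γ) (x₀ : X) (i j : ℤ) :
    dist (g ^ i • x₀) (g ^ j • x₀) = dist x₀ (g ^ |i - j| • x₀) := by
  rcases abs_choice (i - j) with h | h
  · rw [h, dist_comm, dist_zpow_smul]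
  · rw [h, neg_sub, dist_zpow_smul]

theorem dist_inv_smul (h : Γ) (p q : X) : dist (h⁻¹ • p) q = dist p (h • q) := by
  rw [← dist_smul h, smul_inv_smul]

section Existence

variable {g : Γ} {x₀ : X}

theorem ActsAsRankOne.proper (hg : ActsAsRankOne x₀ g) (D : ℝ) :
    ∃ K : ℤ, ∀ j : ℤ, dist x₀ (g ^ j • x₀) ≤ D → |j| ≤ K := by
  obtain ⟨N, hN⟩ := eventually_atTop.1 (hg.1.eventually_gt_atTop D)
  refine ⟨N, fun j hj => ?_⟩
  by_contra hlt
  have h1 := hN j.natAbs (by rw [Int.abs_eq_natAbs] at hlt; omega)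
  have h2 := dist_zpow_smul_abs g x₀ 0 j
  rw [zero_sub, abs_neg, Int.abs_eq_natAbs, zpow_natCast, zpow_zero, one_smul] at h2
  rw [h2, dist_comm] at hj
  linarith

/-- A nearest orbit point can be chosen equivariantly, as the one with the least exponent. -/
theorem ActsAsRankOne.exists_nearest (hg : ActsAsRankOne x₀ g) :
    ∃ κ : X → ℤ, (∀ p, κ (g • p) = κ p + 1) ∧ κ x₀ = 0 ∧
      ∀ p (j : ℤ), dist p (g ^ κ p • x₀) ≤ dist p (g ^ j • x₀) := by
  set M : X → Set ℤ := fun p => {k | ∀ j : ℤ, dist p (g ^ k • x₀) ≤ dist p (g ^ j • x₀)} with hM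
  have hfin : ∀ p, {k : ℤ | dist p (g ^ k • x₀) ≤ dist p x₀}.Finite := by
    intro p
    obtain ⟨K, hK⟩ := hg.proper (2 * dist p x₀)
    refine (finite_Icc (-K) K).subset fun k hk => abs_le.1 (hK k ?_)
    have hk : dist p (g ^ k • x₀) ≤ dist p x₀ := hk
    have := dist_triangle_left x₀ (g ^ k • x₀) p
    linarith
  have hne : ∀ p, (M p).Nonempty := by
    intro p
    obtain ⟨k, hk, hmin⟩ := exists_min_image _ (fun k : ℤ => dist p (g ^ k • x₀)) (hfin p)
      ⟨0, by simp⟩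
    refine ⟨k, fun j => ?_⟩
    by_cases hj : dist p (g ^ j • x₀) ≤ dist p x₀
    · exact hmin j hj
    · exact le_trans hk (not_le.1 hj).le
  have hbdd : ∀ p, BddBelow (M p) := fun p =>
    (hfin p).bddBelow.mono fun k hk => by simpa using hk 0
  have hshift : ∀ (p : X) (k : ℤ), k ∈ M p ↔ k + 1 ∈ M (g • p) := by
    intro p k
    have hd : ∀ j : ℤ, dist (g • p) (g ^ (j + 1) • x₀) = dist p (g ^ j • x₀) := fun j => by
      rw [add_comm, zpow_add, zpow_one, mul_smul, dist_smul]
    constructor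
    · intro hk j
      have := hk (j - 1)
      rwa [← hd, ← hd, sub_add_cancel] at this
    · intro hk j
      have := hk (j + 1)
      rwa [hd, hd] at this
  refine ⟨fun p => sInf (M p), fun p => ?_, ?_, fun p => Int.csInf_mem (hne p) (hbdd p)⟩
  · refine le_antisymm ?_ ?_
    · exact csInf_le (hbdd _) ((hshift p _).1 (Int.csInf_mem (hne p) (hbdd p)))
    · have h := Int.csInf_mem (hne (g • p)) (hbdd _)
      rw [← sub_add_cancel (sInf (M (g • p))) 1, ← hshift] at h
      have := csInf_le (hbdd p) h
      change sInf (M p) + 1 ≤ sInf (M (g • p))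
      linarith
  · -- an exponent `k` with `g ^ k • x₀ = x₀` vanishes since the orbit is unbounded
    obtain ⟨K, hK⟩ := hg.proper 0
    have h := Int.csInf_mem (hne x₀) (hbdd _) 0
    set k := sInf (M x₀)
    rw [zpow_zero, one_smul, dist_self] at h
    have hfix : g ^ k • x₀ = x₀ := (dist_le_zero.1 h).symm
    have hn : ∀ n : ℕ, g ^ (k * n) • x₀ = x₀ := by
      intro n
      induction n with
      | zero => simp
      | succ n ih => rw [Nat.cast_succ, mul_add, mul_one, zpow_add, mul_smul, hfix, ih]
    have h1 := hK (k * (K.natAbs + 1 : ℕ)) (by rw [hn, dist_self])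
    change k = 0
    by_contra hk0
    have h2 : 1 ≤ |k| := Int.one_le_abs hk0
    rw [abs_mul, Nat.abs_cast] at h1
    push_cast at h1
    have h3 := le_abs_self K
    nlinarith [abs_nonneg K]

theorem ActsAsRankOne.exists_orbitAxis (hX : IsCAT0 X) (hg : ActsAsRankOne x₀ g) :
    ∃ κ C, OrbitAxis g x₀ κ C := by
  obtain ⟨κ, hsmul, hbase, hnear⟩ := hg.exists_nearest
  obtain ⟨B, hB, hseg⟩ := hg.2
  have hzsmul : ∀ (n : ℕ) (p : X), κ (g ^ n • p) = κ p + n := by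
    intro n p
    induction n with
    | zero => simp
    | succ n ih => rw [pow_succ', mul_smul, hsmul, ih]; push_cast; ring
  have hseg' : ∀ n : ℕ, 0 < n → ∃ S, IsGeodesicSegment S x₀ (g ^ n • x₀) ∧
      HausdorffEquivalent B S ((fun k : ℕ => g ^ k • x₀) '' Iic n) ∧ IsContracting B S := by
    intro n hn
    obtain ⟨⟨S, hS, h1⟩, ⟨T, hT, h2⟩⟩ := hseg n hn
    rw [hX.isGeodesicSegment_unique hT hS] at h2
    exact ⟨S, hS, h1, h2⟩
  have hadd : ∀ a n : ℕ, a ≤ n → dist x₀ (g ^ a • x₀) + dist (g ^ a • x₀) (g ^ n • x₀) ≤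
      dist x₀ (g ^ n • x₀) + 2 * B := by
    intro a n han
    rcases Nat.eq_zero_or_pos n with rfl | hn
    · obtain rfl : a = 0 := by omega
      simp
      linarith
    obtain ⟨S, hS, h1, -⟩ := hseg' n hn
    obtain ⟨s, hs, hd⟩ := Metric.mem_thickening_iff.1 (h1.2 (mem_image_of_mem _ (mem_Iic.2 han)))
    have h2 := hS.dist_add_dist hs
    have h3 := dist_triangle x₀ s (g ^ a • x₀)
    have h4 := dist_triangle (g ^ a • x₀) s (g ^ n • x₀)
    rw [dist_comm s] at h3
    linarith
  have hadd' : ∀ i k j : ℤ, i ≤ k → k ≤ j →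
      dist (g ^ i • x₀) (g ^ k • x₀) + dist (g ^ k • x₀) (g ^ j • x₀) ≤
        dist (g ^ i • x₀) (g ^ j • x₀) + 2 * B := by
    intro i k j hik hkj
    have h := hadd (k - i).toNat (j - i).toNat (by omega)
    simp only [← zpow_natCast, Int.toNat_of_nonneg (sub_nonneg.2 hik),
      Int.toNat_of_nonneg (sub_nonneg.2 (hik.trans hkj))] at h
    rw [dist_zpow_smul g x₀ (k - i), sub_sub_sub_cancel_right] at h
    simpa only [dist_zpow_smul g x₀] using h
  -- nearest points on a geodesic segment and nearest points on the orbit are close to each other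
  have hproj : ∀ (n : ℕ) (S : Set X), IsGeodesicSegment S x₀ (g ^ n • x₀) →
      HausdorffEquivalent B S ((fun k : ℕ => g ^ k • x₀) '' Iic n) → IsContracting B S →
      ∀ (p : X) (a : ℕ), κ p = a → a ≤ n → ∀ p' ∈ nearestPoints S p,
      dist p' (g ^ a • x₀) ≤ 15 * B := by
    intro n S hS h1 h2 p a hpa han p' hp'
    obtain ⟨s, hs, hd⟩ := Metric.mem_thickening_iff.1 (h1.2 (mem_image_of_mem _ (mem_Iic.2 han)))
    obtain ⟨_, ⟨k, hk, rfl⟩, hd'⟩ := Metric.mem_thickening_iff.1 (h1.1 hp'.1)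
    have h3 := hnear p k
    rw [hpa, zpow_natCast, zpow_natCast] at h3
    have hss : s ∈ nearestPoints S s := ⟨hs, fun q _ => by simp⟩
    have h4 : dist p s ≤ dist p p' + 2 * B := by
      have := dist_triangle p (g ^ a • x₀) s
      have := dist_triangle p p' (g ^ k • x₀)
      dsimp only at hd'
      linarith
    have h5 : dist p' s ≤ 14 * B := by
      by_contra hlt
      have := h2.dist_add_dist_le hX hS.isCompact hS.nonempty hB hp' hss (by linarith)
      rw [dist_self] at this
      linarith
    have := dist_triangle p' s (g ^ a • x₀)
    rw [dist_comm s] at this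
    linarith
  refine ⟨κ, 72 * B, by linarith, hsmul, hbase, hnear, hg.proper, ?_, ?_⟩
  · rintro i k j (⟨h1, h2⟩ | ⟨h1, h2⟩)
    · linarith [hadd' i k j h1 h2]
    · have := hadd' j k i h1 h2
      rw [dist_comm (g ^ i • x₀) (g ^ k • x₀), dist_comm (g ^ k • x₀) (g ^ j • x₀),
        dist_comm (g ^ i • x₀) (g ^ j • x₀)]
      linarith
  · -- translate by a power of `g`, so that both exponents become nonnegative
    have hnat : ∀ (p q : X) (a b : ℕ), κ p = a → κ q = b →
        72 * B ≤ dist (g ^ a • x₀) (g ^ b • x₀) →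
        dist p (g ^ a • x₀) + dist (g ^ a • x₀) (g ^ b • x₀) + dist (g ^ b • x₀) q ≤
          dist p q + 72 * B := by
      intro p q a b hpa hqb hab
      obtain ⟨S, hS, h1, h2⟩ := hseg' (a + b + 1) (by omega)
      obtain ⟨p', hp'⟩ := hS.isCompact.nearestPoints_nonempty hS.nonempty p
      obtain ⟨q', hq'⟩ := hS.isCompact.nearestPoints_nonempty hS.nonempty q
      have h3 := hproj _ S hS h1 h2 p a hpa (by omega) p' hp'
      have h4 := hproj _ S hS h1 h2 q b hqb (by omega) q' hq'
      have h5 := dist_triangle4 (g ^ a • x₀) p' q' (g ^ b • x₀)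
      rw [dist_comm _ p'] at h5
      have h6 := h2.dist_add_dist_le hX hS.isCompact hS.nonempty hB hp' hq' (by linarith)
      have h7 := dist_triangle p p' (g ^ a • x₀)
      have h8 := dist_triangle_left (g ^ b • x₀) q q'
      linarith
    intro p q hpq
    set n := (κ p).natAbs + (κ q).natAbs with hn
    have e1 : g ^ (κ p + n).toNat • x₀ = g ^ n • g ^ κ p • x₀ := by
      rw [← zpow_natCast, Int.toNat_of_nonneg (by omega), add_comm, zpow_add, mul_smul,
        zpow_natCast]
    have e2 : g ^ (κ q + n).toNat • x₀ = g ^ n • g ^ κ q • x₀ := by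
      rw [← zpow_natCast, Int.toNat_of_nonneg (by omega), add_comm, zpow_add, mul_smul,
        zpow_natCast]
    have h := hnat (g ^ n • p) (g ^ n • q) (κ p + n).toNat (κ q + n).toNat
      (by rw [hzsmul]; omega) (by rw [hzsmul]; omega)
    simpa only [e1, e2, dist_smul, hpq, forall_true_left] using h

end Existence

end OrbitAxes

/-! ### Translates of the axis that fellow travel -/

section FellowTravel

variable {Γ X : Type*} [Group Γ] [MetricSpace X] [MulAction Γ X]

namespace OrbitAxis

variable {g : Γ} {x₀ : X} {κ : X → ℤ} {C : ℝ}

theorem coord_orbit (A : OrbitAxis g x₀ κ C) (k : ℤ) : κ (g ^ k • x₀) = k := by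
  rw [coord_zpow_smul A.smul, A.base, zero_add]

theorem dist_add_dist_le (A : OrbitAxis g x₀ κ C) (p : X) (j : ℤ) :
    dist p (g ^ κ p • x₀) + dist (g ^ κ p • x₀) (g ^ j • x₀) ≤ dist p (g ^ j • x₀) + C := by
  rcases le_total C (dist (g ^ κ p • x₀) (g ^ j • x₀)) with h | h
  · have := A.contract p (g ^ j • x₀) (by rwa [A.coord_orbit])
    rw [A.coord_orbit, dist_self] at this
    linarith
  · linarith [A.dist_le p j]

theorem dist_coord_le (A : OrbitAxis g x₀ κ C) (p q : X) :
    dist (g ^ κ p • x₀) (g ^ κ q • x₀) ≤ dist p q + C := by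
  rcases le_total C (dist (g ^ κ p • x₀) (g ^ κ q • x₀)) with h | h
  · have := A.contract p q h
    linarith [dist_nonneg (x := p) (y := g ^ κ p • x₀), dist_nonneg (x := g ^ κ q • x₀) (y := q)]
  · linarith [dist_nonneg (x := p) (y := q)]

end OrbitAxis

variable [IsIsometricSMul Γ X]

/-- A coarsely isometric map from an interval to `ℤ` is coarsely affine. -/
theorem exists_affine_of_coarse_isometry {u : ℤ → ℤ} {i j K : ℤ} (hij : i ≤ j)
    (h : ∀ k m, i ≤ k → k ≤ j → i ≤ m → m ≤ j → |(|u k - u m| - |k - m|)| ≤ K) :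
    ∃ ε c : ℤ, (ε = 1 ∨ ε = -1) ∧ ∀ k, i ≤ k → k ≤ j → |u k - (ε * k + c)| ≤ 3 * K := by
  have main : ∀ k, i ≤ k → k ≤ j →
      (u i ≤ u j → |u k - u i - (k - i)| ≤ 3 * K) ∧
      (u j ≤ u i → |u k - u i + (k - i)| ≤ 3 * K) := by
    intro k hk hkj
    have h1 := h k i hk hkj le_rfl hij
    have h2 := h j k hij le_rfl hk hkj
    have h3 := h j i hij le_rfl le_rfl hij
    rw [abs_of_nonneg (sub_nonneg.2 hk)] at h1
    rw [abs_of_nonneg (sub_nonneg.2 hkj)] at h2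
    rw [abs_of_nonneg (sub_nonneg.2 hij)] at h3
    rw [abs_le] at h1 h2 h3
    constructor
    · intro huv
      rw [abs_of_nonneg (sub_nonneg.2 huv)] at h3
      rw [abs_le]
      rcases abs_cases (u k - u i) with ⟨e1, _⟩ | ⟨e1, _⟩ <;>
      rcases abs_cases (u j - u k) with ⟨e2, _⟩ | ⟨e2, _⟩ <;>
      rw [e1] at h1 <;> rw [e2] at h2 <;> omega
    · intro huv
      rw [abs_of_nonpos (sub_nonpos.2 huv)] at h3
      rw [abs_le]
      rcases abs_cases (u k - u i) with ⟨e1, _⟩ | ⟨e1, _⟩ <;>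
      rcases abs_cases (u j - u k) with ⟨e2, _⟩ | ⟨e2, _⟩ <;>
      rw [e1] at h1 <;> rw [e2] at h2 <;> omega
  rcases le_total (u i) (u j) with huv | huv
  · refine ⟨1, u i - i, Or.inl rfl, fun k hk hkj => ?_⟩
    have := (main k hk hkj).1 huv
    rwa [show u k - (1 * k + (u i - i)) = u k - u i - (k - i) by ring]
  · refine ⟨-1, u i + i, Or.inr rfl, fun k hk hkj => ?_⟩
    have := (main k hk hkj).2 huv
    rwa [show u k - (-1 * k + (u i + i)) = u k - u i + (k - i) by ring]

theorem exists_dist_orbit_le (g : Γ) (x₀ : X) (n : ℤ) :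
    ∃ W : ℝ, ∀ i j : ℤ, |i - j| ≤ n → dist (g ^ i • x₀) (g ^ j • x₀) ≤ W := by
  obtain ⟨W, hW⟩ := ((finite_Icc 0 n).image (fun k : ℤ => dist x₀ (g ^ k • x₀))).bddAbove
  refine ⟨W, fun i j hij => ?_⟩
  rw [dist_zpow_smul_abs]
  exact hW (mem_image_of_mem _ ⟨abs_nonneg _, hij⟩)

namespace OrbitAxis

variable {g : Γ} {x₀ : X} {κ : X → ℤ} {C : ℝ}

theorem abs_sub_le_of_dist_le (A : OrbitAxis g x₀ κ C) (D : ℝ) :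
    ∃ K : ℤ, 0 ≤ K ∧ ∀ i j : ℤ, dist (g ^ i • x₀) (g ^ j • x₀) ≤ D → |i - j| ≤ K := by
  obtain ⟨K, hK⟩ := A.proper D
  refine ⟨max K 0, le_max_right _ _, fun i j h => ?_⟩
  rw [dist_zpow_smul_abs] at h
  have := hK _ h
  rw [abs_abs] at this
  exact this.trans (le_max_left _ _)

theorem abs_coord_sub_le (A : OrbitAxis g x₀ κ C) (D : ℝ) :
    ∃ K : ℤ, 0 ≤ K ∧ ∀ p q, dist p q ≤ D → |κ p - κ q| ≤ K := by
  obtain ⟨K, hK0, hK⟩ := A.abs_sub_le_of_dist_le (D + C)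
  exact ⟨K, hK0, fun p q h => hK _ _ ((A.dist_coord_le p q).trans (by linarith))⟩

/-- If a translate of the axis has a large projection to the axis, then it passes close to all
orbit points in the range of the projection. -/
theorem dist_translate_le (A : OrbitAxis g x₀ κ C) (h : Γ) (a b : ℤ)
    (hab : C ≤ dist (g ^ κ (h • g ^ a • x₀) • x₀) (g ^ κ (h • g ^ b • x₀) • x₀)) (k : ℤ)
    (hk₁ : κ (h • g ^ a • x₀) ≤ k) (hk₂ : k ≤ κ (h • g ^ b • x₀)) :
    dist (g ^ k • x₀) (h • g ^ κ (h⁻¹ • g ^ k • x₀) • x₀) ≤ 2 * C := by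
  have h1 := A.contract _ _ hab
  have h2 := A.additive _ k _ (Or.inl ⟨hk₁, hk₂⟩)
  have h3 := A.dist_add_dist_le (h⁻¹ • g ^ k • x₀) a
  have h4 := A.dist_add_dist_le (h⁻¹ • g ^ k • x₀) b
  simp only [dist_inv_smul] at h3 h4
  set u := κ (h⁻¹ • g ^ k • x₀)
  have h5 := dist_triangle4 (h • g ^ a • x₀) (g ^ κ (h • g ^ a • x₀) • x₀) (g ^ k • x₀)
    (h • g ^ b • x₀)
  have h6 := dist_triangle (g ^ k • x₀) (g ^ κ (h • g ^ b • x₀) • x₀) (h • g ^ b • x₀)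
  have h7 := dist_triangle_left (g ^ a • x₀) (g ^ b • x₀) (g ^ u • x₀)
  rw [← dist_smul h (g ^ a • x₀)] at h7
  have h8 := dist_triangle (g ^ k • x₀) (g ^ κ (h • g ^ a • x₀) • x₀) (h • g ^ a • x₀)
  rw [dist_comm (g ^ k • x₀) (g ^ κ (h • g ^ a • x₀) • x₀),
    dist_comm (g ^ κ (h • g ^ a • x₀) • x₀) (h • g ^ a • x₀)] at h8
  linarith

theorem abs_abs_sub_abs_le (A : OrbitAxis g x₀ κ C) (D : ℝ) :
    ∃ K : ℤ, ∀ a b c d : ℤ, |dist (g ^ a • x₀) (g ^ b • x₀) - dist (g ^ c • x₀) (g ^ d • x₀)| ≤ D →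
      |(|a - b| - |c - d|)| ≤ K := by
  obtain ⟨K, -, hK⟩ := A.abs_sub_le_of_dist_le (D + C)
  have key : ∀ n m : ℤ, 0 ≤ m → m ≤ n → dist x₀ (g ^ n • x₀) - dist x₀ (g ^ m • x₀) ≤ D →
      n - m ≤ K := by
    intro n m hm hmn hd
    have h1 := A.additive 0 m n (Or.inl ⟨hm, hmn⟩)
    rw [zpow_zero, one_smul] at h1
    have h2 := hK n m (by rw [dist_comm]; linarith)
    exact (le_abs_self _).trans h2
  refine ⟨K, fun a b c d hd => ?_⟩
  rw [dist_zpow_smul_abs, dist_zpow_smul_abs g x₀ c d, abs_le] at hd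
  rw [abs_le]
  rcases le_total |c - d| |a - b| with hle | hle
  · have := key _ _ (abs_nonneg _) hle (by linarith)
    constructor <;> linarith
  · have := key _ _ (abs_nonneg _) hle (by linarith)
    constructor <;> linarith

theorem exists_fellowTravel (A : OrbitAxis g x₀ κ C) :
    ∃ (D : ℝ) (N : ℤ), 0 < D ∧ 0 ≤ N ∧ ∀ (h : Γ) (a b : ℤ),
      N ≤ κ (h • g ^ b • x₀) - κ (h • g ^ a • x₀) →
      ∃ ε c : ℤ, (ε = 1 ∨ ε = -1) ∧ ∀ k, κ (h • g ^ a • x₀) ≤ k → k ≤ κ (h • g ^ b • x₀) →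
        dist (g ^ k • x₀) (h • g ^ (ε * k + c) • x₀) ≤ D := by
  obtain ⟨K, hK⟩ := A.abs_abs_sub_abs_le (4 * C)
  obtain ⟨W, hW⟩ := exists_dist_orbit_le g x₀ (3 * K)
  obtain ⟨N, hN0, hN⟩ := A.abs_sub_le_of_dist_le C
  refine ⟨max (2 * C + W) 1, N + 1, by positivity, by omega, fun h a b hab => ?_⟩
  set i := κ (h • g ^ a • x₀) with hi
  set j := κ (h • g ^ b • x₀) with hj
  have hC : C ≤ dist (g ^ i • x₀) (g ^ j • x₀) := by
    by_contra hlt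
    have := hN i j (not_le.1 hlt).le
    rw [abs_le] at this
    omega
  have hd := A.dist_translate_le h a b hC
  set u : ℤ → ℤ := fun k => κ (h⁻¹ • g ^ k • x₀) with hu
  obtain ⟨ε, c, hε, hc⟩ := exists_affine_of_coarse_isometry (u := u) (i := i) (j := j) (K := K)
    (by omega) (fun k m hik hkj him hmj => hK _ _ _ _ (by
      have h1 := hd k hik hkj
      have h2 := hd m him hmj
      have h3 := dist_dist_dist_le (g ^ k • x₀) (g ^ m • x₀) (h • g ^ u k • x₀) (h • g ^ u m • x₀)
      rw [dist_smul, Real.dist_eq, abs_sub_comm] at h3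
      exact h3.trans (by linarith)))
  refine ⟨ε, c, hε, fun k hik hkj => ?_⟩
  have h1 := hd k hik hkj
  have h2 := hW _ _ (hc k hik hkj)
  have h3 := dist_triangle (g ^ k • x₀) (h • g ^ u k • x₀) (h • g ^ (ε * k + c) • x₀)
  rw [dist_smul h] at h3
  exact (h3.trans (by linarith)).trans (le_max_left _ _)

end OrbitAxis

/-! ### The coarse stabilizer of the axis -/

/-- The elements that conjugate some nontrivial power of `g` to itself or to its inverse. -/
def coarseStabilizer (g : Γ) : Subgroup Γ where
  carrier := {h | ∃ n ε : ℤ, n ≠ 0 ∧ (ε = 1 ∨ ε = -1) ∧ h * g ^ n * h⁻¹ = g ^ (ε * n)}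
  one_mem' := ⟨1, 1, by simp⟩
  mul_mem' := by
    rintro h₁ h₂ ⟨n₁, ε₁, hn₁, hε₁, e₁⟩ ⟨n₂, ε₂, hn₂, hε₂, e₂⟩
    refine ⟨n₁ * n₂, ε₁ * ε₂, mul_ne_zero hn₁ hn₂, ?_, ?_⟩
    · rcases hε₁ with rfl | rfl <;> rcases hε₂ with rfl | rfl <;> simp
    · calc h₁ * h₂ * g ^ (n₁ * n₂) * (h₁ * h₂)⁻¹
          = h₁ * (h₂ * g ^ n₂ * h₂⁻¹) ^ n₁ * h₁⁻¹ := by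
            rw [conj_zpow, ← zpow_mul, mul_comm n₂]
            group
        _ = (h₁ * g ^ n₁ * h₁⁻¹) ^ (ε₂ * n₂) := by
            rw [e₂, conj_zpow, ← zpow_mul, ← zpow_mul, mul_comm n₁]
        _ = g ^ (ε₁ * ε₂ * (n₁ * n₂)) := by
            rw [e₁, ← zpow_mul]
            ring_nf
  inv_mem' := by
    rintro h ⟨n, ε, hn, hε, e⟩
    refine ⟨n, ε, hn, hε, ?_⟩
    have hεε : ε * n * ε = n := by rcases hε with rfl | rfl <;> simp
    calc h⁻¹ * g ^ n * h⁻¹⁻¹ = h⁻¹ * (h * g ^ n * h⁻¹) ^ ε * h := by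
          rw [e, ← zpow_mul, hεε, inv_inv]
      _ = g ^ (ε * n) := by
          rw [conj_zpow, ← zpow_mul, mul_comm n]
          group

theorem mem_coarseStabilizer_self (g : Γ) : g ∈ coarseStabilizer g :=
  ⟨1, 1, by simp⟩

/-- Weak proper discontinuity along the axis of `g`. -/
def WPDAlong (g : Γ) (x₀ : X) : Prop :=
  ∀ c : ℝ, 0 < c → ∃ M : ℕ, 0 < M ∧
    {γ : Γ | dist x₀ (γ • x₀) ≤ c ∧ dist (g ^ M • x₀) (γ • g ^ M • x₀) ≤ c}.Finite

/-- Two elements that move two distant points of the axis to about the same points differ by an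
element of a finite set. -/
theorem WPDAlong.exists_finite {g : Γ} {x₀ : X} (hW : WPDAlong g x₀) {D : ℝ} (hD : 0 < D) :
    ∃ (M : ℕ) (F : Finset Γ), ∀ (ε : ℤ) (a b : Γ),
      dist x₀ (a • x₀) ≤ D → dist (g ^ (M : ℤ) • x₀) (a • g ^ (ε * M) • x₀) ≤ D →
      dist x₀ (b • x₀) ≤ D → dist (g ^ (M : ℤ) • x₀) (b • g ^ (ε * M) • x₀) ≤ D →
      a * b⁻¹ ∈ F := by
  obtain ⟨M, hM, hfin⟩ := hW (2 * D) (by linarith)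
  refine ⟨M, hfin.toFinset, fun ε a b ha ha' hb hb' => ?_⟩
  have key : ∀ p q : X, dist q (a • p) ≤ D → dist q (b • p) ≤ D →
      dist q ((a * b⁻¹) • q) ≤ 2 * D := by
    intro p q h1 h2
    have h3 := dist_triangle q (a • p) (a • b⁻¹ • q)
    rw [dist_smul, dist_comm p, dist_inv_smul] at h3
    rw [mul_smul]
    linarith
  rw [Set.Finite.mem_toFinset]
  refine ⟨key _ _ ha hb, ?_⟩
  rw [← zpow_natCast]
  exact key _ _ ha' hb'

/-- A translate of the axis that fellow travels with the axis for long enough is a translate by an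
element of the coarse stabilizer: the elements which shift along the axis, apply `h`, and shift back
cannot all be distinct. -/
theorem WPDAlong.exists_mem_coarseStabilizer {g : Γ} {x₀ : X} (hW : WPDAlong g x₀) {D : ℝ}
    (hD : 0 < D) : ∃ L : ℤ, 0 ≤ L ∧ ∀ (h : Γ) (ε c i : ℤ), (ε = 1 ∨ ε = -1) →
      (∀ k, i ≤ k → k ≤ i + L → dist (g ^ k • x₀) (h • g ^ (ε * k + c) • x₀) ≤ D) →
      h ∈ coarseStabilizer g := by
  obtain ⟨M, F, hF⟩ := hW.exists_finite hD
  refine ⟨M + F.card, by positivity, fun h ε c i hε hd => ?_⟩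
  set γ : ℕ → Γ := fun k => g ^ (-(i + k)) * h * g ^ (ε * (i + k) + c) with hγ
  have hmove : ∀ k : ℕ, k < F.card + 1 → ∀ l : ℤ, 0 ≤ l → l ≤ M →
      dist (g ^ l • x₀) (γ k • g ^ (ε * l) • x₀) ≤ D := by
    intro k hk l hl hl'
    have h1 := hd (i + k + l) (by omega) (by omega)
    rw [← dist_smul (g ^ (-(i + (k : ℤ))))] at h1
    have e1 : g ^ (-(i + (k : ℤ))) • g ^ (i + k + l) • x₀ = g ^ l • x₀ := by
      rw [smul_smul, ← zpow_add]
      congr 2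
      ring
    have e2 : g ^ (-(i + (k : ℤ))) • h • g ^ (ε * (i + k + l) + c) • x₀ =
        γ k • g ^ (ε * l) • x₀ := by
      simp only [hγ, smul_smul, mul_assoc, ← zpow_add]
      congr 4
      ring
    rwa [e1, e2] at h1
  have hmaps : ∀ k ∈ Finset.range (F.card + 1), γ k * (γ 0)⁻¹ ∈ F := by
    intro k hk
    have hk' : k < F.card + 1 := Finset.mem_range.1 hk
    have h1 := hmove k hk' 0 le_rfl (by positivity)
    have h2 := hmove 0 (by omega) 0 le_rfl (by positivity)
    simp only [mul_zero, zpow_zero, one_smul] at h1 h2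
    exact hF ε _ _ h1 (hmove k hk' M (by positivity) le_rfl) h2
      (hmove 0 (by omega) M (by positivity) le_rfl)
  obtain ⟨k, -, l, -, hkl, heq⟩ := Finset.exists_ne_map_eq_of_card_lt_of_maps_to (by simp) hmaps
  replace heq : g ^ (-(i + k) : ℤ) * h * g ^ (ε * (i + k) + c) =
      g ^ (-(i + l) : ℤ) * h * g ^ (ε * (i + l) + c) := mul_right_cancel heq
  have hεε : ε * ε = 1 := by rcases hε with rfl | rfl <;> rfl
  have hε0 : ε ≠ 0 := by rcases hε with rfl | rfl <;> simp
  refine ⟨ε * (k - l), ε, mul_ne_zero hε0 (by omega), hε, ?_⟩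
  rw [← mul_assoc, hεε, one_mul]
  calc h * g ^ (ε * ((k : ℤ) - l)) * h⁻¹
      = g ^ (i + k : ℤ) * (g ^ (-(i + k) : ℤ) * h * g ^ (ε * (i + k) + c)) *
          g ^ (-(ε * (i + l) + c)) * h⁻¹ := by
        have : ε * ((k : ℤ) - l) = (ε * (i + k) + c) + -(ε * (i + l) + c) := by ring
        rw [this, zpow_add, zpow_neg g (i + k : ℤ)]
        simp only [mul_assoc, mul_inv_cancel_left]
    _ = g ^ ((k : ℤ) - l) := by
        rw [heq, zpow_neg g (ε * (i + l) + c)]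
        simp only [mul_assoc, mul_inv_cancel, mul_one]
        rw [← zpow_add]
        congr 1
        ring

namespace OrbitAxis

variable {g : Γ} {x₀ : X} {κ : X → ℤ} {C : ℝ}

/-- Elements of the coarse stabilizer move the axis a uniformly bounded distance, up to a shift and
possibly a reversal. -/
theorem exists_dist_stabilizer_le (A : OrbitAxis g x₀ κ C) :
    ∃ D : ℝ, 0 < D ∧ ∀ h ∈ coarseStabilizer g, ∃ ε c : ℤ, (ε = 1 ∨ ε = -1) ∧
      ∀ k : ℤ, dist (g ^ k • x₀) (h • g ^ (ε * k + c) • x₀) ≤ D := by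
  obtain ⟨D, N, hD, hN, hft⟩ := A.exists_fellowTravel
  obtain ⟨K, hK0, hK⟩ := A.abs_sub_le_of_dist_le (2 * D)
  obtain ⟨W, hW⟩ := exists_dist_orbit_le g x₀ K
  refine ⟨max (D + W) 1, by positivity, ?_⟩
  rintro h ⟨n, ε₁, hn, hε₁, e⟩
  -- the projection of the translate to the axis is unbounded in both directions
  have hshift : ∀ m : ℤ, κ (h • g ^ (n * m) • x₀) = κ (h • x₀) + ε₁ * n * m := by
    intro m
    have : h * g ^ (n * m) = g ^ (ε₁ * n * m) * h := by
      rw [zpow_mul, zpow_mul, ← e, conj_zpow]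
      group
    rw [smul_smul, this, mul_smul, coord_zpow_smul A.smul]
  have hwin : ∀ Z : ℤ, N ≤ 2 * Z → ∃ ε c : ℤ, (ε = 1 ∨ ε = -1) ∧
      ∀ k, -Z ≤ k → k ≤ Z → dist (g ^ k • x₀) (h • g ^ (ε * k + c) • x₀) ≤ D := by
    intro Z hZ
    obtain ⟨a, b, ha, hb⟩ : ∃ a b : ℤ, κ (h • g ^ a • x₀) ≤ -Z ∧ Z ≤ κ (h • g ^ b • x₀) := by
      set T := Z + |κ (h • x₀)| with hT
      have h1 := abs_le.1 (le_refl |κ (h • x₀)|)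
      have hq : 1 ≤ (ε₁ * n) * (ε₁ * n) := by
        have : ε₁ * n ≠ 0 := mul_ne_zero (by rcases hε₁ with rfl | rfl <;> simp) hn
        have := mul_self_pos.2 this
        omega
      have hT0 : 0 ≤ T := by
        have := abs_nonneg (κ (h • x₀))
        omega
      have h2 : T ≤ (ε₁ * n) * (ε₁ * n) * T := by nlinarith
      refine ⟨n * (-(ε₁ * n) * T), n * (ε₁ * n * T), ?_, ?_⟩
      · rw [hshift]
        linarith
      · rw [hshift]
        linarith
    obtain ⟨ε, c, hε, hc⟩ := hft h a b (by linarith)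
    exact ⟨ε, c, hε, fun k hk hk' => hc k (ha.trans hk) (hk'.trans hb)⟩
  set Z₀ := K + N + 1 with hZ₀
  obtain ⟨ε₀, c₀, hε₀, hc₀⟩ := hwin Z₀ (by omega)
  refine ⟨ε₀, c₀, hε₀, fun k => ?_⟩
  -- compare the shift on a window containing `k` with the one on the fixed window
  obtain ⟨ε, c, hε, hc⟩ := hwin (max Z₀ |k|) (by have := le_max_left Z₀ |k|; omega)
  have hcomp : ∀ l, -Z₀ ≤ l → l ≤ Z₀ → |(ε * l + c) - (ε₀ * l + c₀)| ≤ K := by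
    intro l hl hl'
    apply hK
    have h1 := hc l (by have := le_max_left Z₀ |k|; omega) (hl'.trans (le_max_left _ _))
    have h2 := hc₀ l hl hl'
    rw [← dist_smul h]
    exact (dist_triangle_left _ _ (g ^ l • x₀)).trans (by linarith)
  have h1 := abs_le.1 (hcomp Z₀ (by omega) le_rfl)
  have h2 := abs_le.1 (hcomp (-Z₀) le_rfl (by omega))
  have h0 := abs_le.1 (hcomp 0 (by omega) (by omega))
  have hεε : ε = ε₀ := by
    rcases hε with rfl | rfl <;> rcases hε₀ with rfl | rfl <;> omega
  subst hεε
  have hk := hc k ((neg_le_neg (le_max_right _ _)).trans (neg_abs_le k))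
    ((le_abs_self k).trans (le_max_right _ _))
  have h3 := hW (ε * k + c) (ε * k + c₀) (by rw [abs_le]; constructor <;> linarith)
  have h4 := dist_triangle (g ^ k • x₀) (h • g ^ (ε * k + c) • x₀) (h • g ^ (ε * k + c₀) • x₀)
  rw [dist_smul h] at h4
  exact (h4.trans (by linarith)).trans (le_max_left _ _)

theorem exists_stabilizer (A : OrbitAxis g x₀ κ C) :
    ∃ R : ℤ, ∀ h ∈ coarseStabilizer g, ∃ ε c : ℤ, (ε = 1 ∨ ε = -1) ∧
      ∀ p, |κ (h⁻¹ • p) - ε * κ p - c| ≤ R := by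
  obtain ⟨D, hD, hst⟩ := A.exists_dist_stabilizer_le
  obtain ⟨K, hK0, hK⟩ := A.abs_sub_le_of_dist_le (2 * D + C)
  refine ⟨K, fun h hh => ?_⟩
  obtain ⟨ε, c, hε, hc⟩ := hst h hh
  refine ⟨ε, c, hε, fun p => ?_⟩
  have hεε : ε * ε = 1 := by rcases hε with rfl | rfl <;> rfl
  set m := κ (h⁻¹ • p) with hm
  -- the orbit point corresponding to the nearest point on the translate is almost nearest
  set l := ε * (m - c) with hl
  have h1 := hc l
  rw [hl, ← mul_assoc, hεε, one_mul, sub_add_cancel, ← hl] at h1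
  have h2 := A.dist_le (h⁻¹ • p) (ε * κ p + c)
  rw [dist_inv_smul, dist_inv_smul, ← hm] at h2
  have h3 := hc (κ p)
  have h4 := A.dist_add_dist_le p l
  have h5 := dist_triangle_right p (g ^ l • x₀) (h • g ^ m • x₀)
  have h6 := dist_triangle p (g ^ κ p • x₀) (h • g ^ (ε * κ p + c) • x₀)
  have h7 := hK (κ p) l (by linarith)
  rw [hl] at h7
  rcases hε with rfl | rfl
  · rw [abs_le] at *
    constructor <;> linarith
  · rw [abs_le] at *
    constructor <;> linarith

theorem exists_bounded (A : OrbitAxis g x₀ κ C) (hW : WPDAlong g x₀) :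
    ∃ R : ℤ, 0 ≤ R ∧ ∀ h ∉ coarseStabilizer g, ∀ e ∈ coarseStabilizer g,
      |κ ((h * e) • x₀) - κ (h • x₀)| ≤ R := by
  obtain ⟨D, N, hD, hN, hft⟩ := A.exists_fellowTravel
  obtain ⟨L, hL0, hL⟩ := hW.exists_mem_coarseStabilizer hD
  have h1 : ∀ h ∉ coarseStabilizer g, ∀ a b : ℤ,
      κ (h • g ^ b • x₀) - κ (h • g ^ a • x₀) ≤ max N L := by
    intro h hh a b
    by_contra hlt
    have h2 := le_max_left N L
    have h3 := le_max_right N L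
    obtain ⟨ε, c, hε, hc⟩ := hft h a b (by omega)
    exact hh (hL h ε c _ hε fun k hk hk' => hc k hk (by omega))
  obtain ⟨D₂, hD₂, hst⟩ := A.exists_dist_stabilizer_le
  obtain ⟨K, hK0, hK⟩ := A.abs_coord_sub_le D₂
  refine ⟨max N L + K, by positivity, fun h hh e he => ?_⟩
  obtain ⟨ε, c, hε, hc⟩ := hst e he
  have hεε : ε * ε = 1 := by rcases hε with rfl | rfl <;> rfl
  have h2 := hc (-(ε * c))
  rw [show ε * -(ε * c) + c = 0 by linear_combination (-c) * hεε, zpow_zero, one_smul] at h2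
  have h3 := hK (h • g ^ (-(ε * c)) • x₀) (h • e • x₀) (by rwa [dist_smul])
  have h4 := h1 h hh 0 (-(ε * c))
  have h5 := h1 h hh (-(ε * c)) 0
  rw [zpow_zero, one_smul] at h4 h5
  rw [mul_smul]
  rw [abs_le] at *
  constructor <;> linarith

/-- The Behrstock inequality. If it failed for `p`, then a geodesic from `p` to its projection on one
axis would pass close to its projection on the other axis, for both choices of the axes. -/
theorem exists_behrstock (A : OrbitAxis g x₀ κ C) (hW : WPDAlong g x₀) :
    ∃ R : ℤ, ∀ h ∉ coarseStabilizer g, ∀ p,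
      |κ p - κ (h • x₀)| ≤ R ∨ |κ (h⁻¹ • p) - κ (h⁻¹ • x₀)| ≤ R := by
  obtain ⟨R₀, hR₀, hb⟩ := A.exists_bounded hW
  obtain ⟨K, hK0, hK⟩ := A.abs_sub_le_of_dist_le (2 * C)
  have hb' : ∀ h ∉ coarseStabilizer g, ∀ k : ℤ, |κ (h • g ^ k • x₀) - κ (h • x₀)| ≤ R₀ :=
    fun h hh k => by
      have := hb h hh _ ((coarseStabilizer g).zpow_mem (mem_coarseStabilizer_self g) k)
      rwa [mul_smul] at this
  refine ⟨R₀ + K, fun h hh p => ?_⟩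
  by_contra hcon
  push Not at hcon
  obtain ⟨hp1, hp2⟩ := hcon
  set a := κ p with ha
  set m := κ (h⁻¹ • p) with hm
  have hh' : h⁻¹ ∉ coarseStabilizer g := by simpa using hh
  have h1 := hb' h hh m
  have h2 := hb' h⁻¹ hh' a
  have hfar : ∀ i j k : ℤ, |i - j| ≤ R₀ → R₀ + K < |k - j| →
      2 * C < dist (g ^ k • x₀) (g ^ i • x₀) := by
    intro i j k hij hkj
    by_contra hle
    have := hK k i (not_lt.1 hle)
    have := abs_sub_le k i j
    omega
  have h3 := hfar _ _ _ h1 hp1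
  have h4 := hfar _ _ _ h2 hp2
  have hC := A.pos
  have h5 := A.contract p (h • g ^ m • x₀) (by linarith)
  have h6 := A.contract (h⁻¹ • p) (h⁻¹ • g ^ a • x₀) (by linarith)
  rw [dist_smul, dist_inv_smul, ← hm] at h6
  have h7 := dist_nonneg (x := g ^ κ (h • g ^ m • x₀) • x₀) (y := h • g ^ m • x₀)
  have h8 := dist_nonneg (x := g ^ κ (h⁻¹ • g ^ a • x₀) • x₀) (y := h⁻¹ • g ^ a • x₀)
  rw [← ha] at h5
  linarith

/-- If every element coarsely stabilizes the axis, then the powers of `g` have finite index. -/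
theorem isVirtuallyCyclic (A : OrbitAxis g x₀ κ C) (hW : WPDAlong g x₀)
    (hE : ∀ h, h ∈ coarseStabilizer g) : IsVirtuallyCyclic Γ := by
  obtain ⟨D, hD, hst⟩ := A.exists_dist_stabilizer_le
  obtain ⟨M, F, hF⟩ := hW.exists_finite hD
  refine ⟨Subgroup.zpowers g, inferInstance, ?_⟩
  have hfin : ∀ ε : ℤ, {γ : Γ | dist x₀ (γ • x₀) ≤ D ∧
      dist (g ^ (M : ℤ) • x₀) (γ • g ^ (ε * M) • x₀) ≤ D}.Finite := by
    intro ε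
    rcases eq_empty_or_nonempty {γ : Γ | dist x₀ (γ • x₀) ≤ D ∧
      dist (g ^ (M : ℤ) • x₀) (γ • g ^ (ε * M) • x₀) ≤ D} with h | ⟨b, hb⟩
    · rw [h]
      exact finite_empty
    · refine (F.finite_toSet.image (· * b)).subset fun a ha => ?_
      exact ⟨a * b⁻¹, hF ε a b ha.1 ha.2 hb.1 hb.2, by simp⟩
  rw [Subgroup.finiteIndex_iff_finite_quotient, ← Set.finite_univ_iff]
  refine (((hfin 1).union (hfin (-1))).image
    (QuotientGroup.mk (s := Subgroup.zpowers g))).subset fun q _ => ?_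
  obtain ⟨h, rfl⟩ := QuotientGroup.mk_surjective q
  obtain ⟨ε, c, hε, hc⟩ := hst h (hE h)
  refine ⟨h * g ^ c, ?_, ?_⟩
  · have h1 : ∀ k : ℤ, dist (g ^ k • x₀) ((h * g ^ c) • g ^ (ε * k) • x₀) ≤ D := by
      intro k
      have := hc k
      rwa [add_comm, zpow_add, mul_smul, smul_smul h] at this
    have h2 := h1 0
    rw [mul_zero, zpow_zero, one_smul] at h2
    rcases hε with rfl | rfl
    · exact Or.inl ⟨h2, h1 M⟩
    · exact Or.inr ⟨h2, h1 M⟩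
  · rw [QuotientGroup.eq]
    simp

theorem exists_axisSystem (A : OrbitAxis g x₀ κ C) (hX : IsCAT0 X) (hW : WPDAlong g x₀)
    (hcyc : ¬ IsVirtuallyCyclic Γ) :
    ∃ (t : Γ) (R : ℤ), AxisSystem g t x₀ (coarseStabilizer g) κ R := by
  obtain ⟨t, ht⟩ : ∃ t, t ∉ coarseStabilizer g := by
    by_contra hcon
    push Not at hcon
    exact hcyc (A.isVirtuallyCyclic hW hcon)
  obtain ⟨R₁, -, h₁⟩ := A.exists_bounded hW
  obtain ⟨R₂, h₂⟩ := A.exists_behrstock hW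
  obtain ⟨R₃, h₃⟩ := A.exists_stabilizer
  obtain ⟨R₄, -, h₄⟩ := A.abs_coord_sub_le (dist (t • x₀) x₀)
  obtain ⟨R₅, -, h₅⟩ := A.abs_coord_sub_le 1
  set R := max 1 (max R₁ (max R₂ (max R₃ (max R₄ R₅)))) with hR
  have hR0 : 1 ≤ R := by omega
  have hR1 : R₁ ≤ R := by omega
  have hR2 : R₂ ≤ R := by omega
  have hR3 : R₃ ≤ R := by omega
  have hR4 : R₄ ≤ R := by omega
  have hR5 : R₅ ≤ R := by omega
  refine ⟨t, R, hR0, A.smul, A.base, mem_coarseStabilizer_self g, ht, fun h => ?_,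
    fun h hh e he => (h₁ h hh e he).trans hR1,
    fun h hh p => (h₂ h hh p).imp (·.trans hR2) (·.trans hR2), fun h hh => ?_, fun x y => ?_⟩
  · exact (h₄ _ _ (by rw [dist_smul])).trans hR4
  · obtain ⟨ε, c, hε, hc⟩ := h₃ h hh
    exact ⟨ε, c, hε, fun p => (hc p).trans hR3⟩
  · obtain ⟨-, γ, γ0, γ1, hγ, -⟩ := hX.exists_geodesic x y
    obtain ⟨m, hm⟩ := exists_nat_gt (dist x y)
    -- subdivide a geodesic into steps of length less than `1`
    have hm0 : (0 : ℝ) < m := dist_nonneg.trans_lt hm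
    refine ⟨m, fun i => γ (i * (dist x y / m)), by simp [γ0], ?_, fun i hi h => ?_⟩
    · dsimp only
      rw [mul_div_cancel₀ _ hm0.ne', γ1]
    · refine (h₅ _ _ ?_).trans hR5
      have hstep : 0 ≤ dist x y / m := by positivity
      have hmem : ∀ j : ℕ, j ≤ m → (j : ℝ) * (dist x y / m) ∈ Icc 0 (dist x y) := by
        intro j hj
        have hj' : (j : ℝ) ≤ m := by exact_mod_cast hj
        refine ⟨by positivity, ?_⟩
        calc (j : ℝ) * (dist x y / m) ≤ m * (dist x y / m) := by gcongr
          _ = dist x y := mul_div_cancel₀ _ hm0.ne'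
      rw [dist_smul, hγ _ (hmem i hi.le) _ (hmem (i + 1) hi), abs_sub_comm]
      push_cast
      rw [add_mul, add_sub_cancel_left, one_mul, abs_of_nonneg hstep, div_le_one hm0]
      exact hm.le

end OrbitAxis

end FellowTravel

theorem mainTheorem1 {Γ X : Type*} [Group Γ] [MetricSpace X] [MulAction Γ X]
    [IsIsometricSMul Γ X] (hX : IsCAT0 X) (x₀ : X)
    (hcyc : ¬ IsVirtuallyCyclic Γ)
    (hWPD : SatisfiesWPD Γ x₀)
    (hrank : ∃ g : Γ, ActsAsRankOne x₀ g) :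
    ¬ FiniteDimensional ℝ (QHTilde Γ) := by
  obtain ⟨g, hg⟩ := hrank
  obtain ⟨κ, C, A⟩ := hg.exists_orbitAxis hX
  obtain ⟨t, R, hA⟩ := A.exists_axisSystem hX (hWPD.finite_of_rankOne g hg) hcyc
  exact hA.not_finiteDimensional
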